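/- Let $m=(m_0,m_1,\dots)$ be a bounded sequence of integers $m_k\ge 2$, let $G_m=\prod_{k}\mathbb Z/m_k\mathbb Z$ be the corresponding bounded Vilenkin group with normalized Haar measure $\mu$, and put $M_0=1$, $M_{k+1}=m_kM_k$. Write $n=\sum_k n_kM_k$ with $0\le n_k<m_k$, and let $\psi_n(x)=\prod_k \exp(2\pi i\,n_kx_k/m_k)$ be the Vilenkin functions. Let $\mathcal F_n$ be the $\sigma$-algebra generated by the sets $I_n(x)=\{y: y_0=x_0,\dots,y_{n-1}=x_{n-1}\}$, $x\in G_m$. For a complex martingale $f=(f^{(k)})_{k\ge0}$ with respect to $(\mathcal F_k)$ let $\|f\|_{H_p}=\|\sup_k|f^{(k)}|\|_p$, where $\|g\|_p=(\int|g|^p\,d\mu)^{1/p}$, and let $H_p$ be the set of martingales with $\|f\|_{H_p}<\infty$. Let $\widehat f(i)=\lim_k\int f^{(k)}\overline{\psi_i}\,d\mu$, $S_nf=\sum_{i<n}\widehat f(i)\psi_i$, $\sigma_nf=\frac1n\sum_{j=1}^nS_jf$ (and likewise for integrable functions), and let $\omega(1/M_N,f)_{H_p}=\|f-S_{M_N}f\|_{H_p}$,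 where $f-S_{M_N}f$ is the martingale $(f^{(k)}-S_{M_N}f^{(k)})_k$. **Theorem.** Let $0<p\le 1/2$ and $f\in H_p$, and suppose that $$\omega\Big(\frac1{M_N},f\Big)_{H_p}=o\Big(\frac1{M_N^{1/p-2}\,N^{2[1/2+p]}}\Big)\qquad (N\to\infty),$$ where $[\cdot]$ is the integer part. Then $\|\sigma_nf-f\|_p\to0$ as $n\to\infty$, in both senses of this norm: $f^{(k)}$ converges almost everywhere to a function $f^{(\infty)}\in L_p(G_m)$ and $\|\sigma_nf-f^{(\infty)}\|_p\to0$; and $\sup_k\|\sigma_nf^{(k)}-f^{(k)}\|_p\to0$. -/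

import Mathlib

open MeasureTheory ProbabilityTheory Filter Topology
open scoped ENNReal

noncomputable section

namespace Vilenkin

/-- The Vilenkin group `G_m`: the complete direct product of the groups `ℤ / m_k`. -/
abbrev G (m : ℕ → ℕ) : Type := ∀ k : ℕ, ZMod (m k)

/-- The generalized powers `M_0 = 1`, `M_{k+1} = m_k M_k`. -/
def M (m : ℕ → ℕ) : ℕ → ℕ
  | 0 => 1
  | k + 1 => m k * M m k

/-- The `k`-th digit of `n` in the generalized number system `n = ∑ n_k M_k`, `0 ≤ n_k < m_k`. -/
def digit (m : ℕ → ℕ) (n k : ℕ) : ℕ := n / M m k % m k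

/-- The generalized Rademacher function `r_k(x) = exp(2πi x_k / m_k)`. -/
def rademacher (m : ℕ → ℕ) (k : ℕ) (x : G m) : ℂ :=
  Complex.exp (2 * Real.pi * Complex.I * ((x k).val : ℂ) / (m k : ℂ))

/-- The Vilenkin function `ψ_n = ∏_k r_k ^ n_k`. The product is finite: `n_k = 0` for `k ≥ n`
(see `digit_eq_zero`). -/
def psi (m : ℕ → ℕ) (n : ℕ) (x : G m) : ℂ :=
  ∏ k ∈ Finset.range n, rademacher m k x ^ digit m n k

theorem digit_eq_zero (m : ℕ → ℕ) (hm : ∀ k, 2 ≤ m k) {n k : ℕ} (h : n ≤ k) :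
    digit m n k = 0 := by
  have key : ∀ j, j < M m j := by
    intro j
    induction j with
    | zero => simp [M]
    | succ j ih =>
      have := hm j
      simp only [M]
      nlinarith
  simp [digit, Nat.div_eq_of_lt (h.trans_lt (key k))]

/-- The cylinder `I_n(x) = {y | y_0 = x_0, …, y_{n-1} = x_{n-1}}`. -/
def cyl (m : ℕ → ℕ) (n : ℕ) (x : G m) : Set (G m) := {y | ∀ k < n, y k = x k}

/-- The normalized Haar measure of `G_m`: the product of the uniform probability measures. -/
def haar (m : ℕ → ℕ) [∀ k, NeZero (m k)] : Measure (G m) :=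
  Measure.infinitePi fun k => uniformOn (Set.univ : Set (ZMod (m k)))

theorem measurableSet_cyl (m : ℕ → ℕ) (n : ℕ) (x : G m) : MeasurableSet (cyl m n x) := by
  have : cyl m n x = ⋂ k : ℕ, ⋂ _ : k < n, (fun y : G m => y k) ⁻¹' {x k} := by
    ext y; simp [cyl]
  rw [this]
  exact MeasurableSet.iInter fun k => MeasurableSet.iInter fun _ =>
    measurable_pi_apply k (MeasurableSet.singleton _)

theorem finite_cyl (m : ℕ → ℕ) [∀ k, NeZero (m k)] (n : ℕ) :
    {s : Set (G m) | ∃ x, s = cyl m n x}.Finite := by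
  let e : (∀ k : Fin n, ZMod (m k)) → Set (G m) := fun z => {y | ∀ k : Fin n, y k = z k}
  refine (Set.finite_range e).subset ?_
  rintro s ⟨x, rfl⟩
  refine ⟨fun k => x k, ?_⟩
  ext y
  exact ⟨fun h k hk => h ⟨k, hk⟩, fun h k => h k k.2⟩

/-- The filtration whose `n`-th σ-algebra is generated by the cylinders `I_n(x)`, `x ∈ G_m`. -/
def filt (m : ℕ → ℕ) [∀ k, NeZero (m k)] :
    Filtration ℕ (inferInstance : MeasurableSpace (G m)) where
  seq n := MeasurableSpace.generateFrom {s | ∃ x, s = cyl m n x}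
  mono' := by
    intro a b hab
    refine MeasurableSpace.generateFrom_le ?_
    rintro _ ⟨x, rfl⟩
    have h : cyl m a x = ⋃₀ {s | (∃ y, s = cyl m b y) ∧ s ⊆ cyl m a x} := by
      apply Set.Subset.antisymm
      · intro y hy
        refine ⟨cyl m b y, ⟨⟨y, rfl⟩, ?_⟩, fun _ _ => rfl⟩
        intro z hz k hk
        rw [hz k (hk.trans_le hab), hy k hk]
      · exact Set.sUnion_subset fun s hs => hs.2
    rw [h]
    refine MeasurableSet.sUnion (((finite_cyl m b).subset fun s hs => hs.1).countable) ?_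
    exact fun s hs => MeasurableSpace.measurableSet_generateFrom hs.1
  le' n := by
    refine MeasurableSpace.generateFrom_le ?_
    rintro _ ⟨x, rfl⟩
    exact measurableSet_cyl m n x

variable {m : ℕ → ℕ} [∀ k, NeZero (m k)]

/-- The Vilenkin–Fourier coefficient of an integrable function. -/
def coeff (g : G m → ℂ) (i : ℕ) : ℂ :=
  ∫ x, g x * (starRingEnd ℂ) (psi m i x) ∂haar m

/-- The `n`-th partial sum `∑_{k<n} c_k ψ_k` of the Vilenkin series with coefficients `c`. -/
def partialSum (c : ℕ → ℂ) (n : ℕ) (x : G m) : ℂ :=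
  ∑ k ∈ Finset.range n, c k * psi m k x

/-- The `n`-th Fejér mean `(1/n) ∑_{k=1}^n S_k` of the Vilenkin series with coefficients `c`. -/
def fejer (c : ℕ → ℂ) (n : ℕ) (x : G m) : ℂ :=
  (1 / (n : ℂ)) * ∑ k ∈ Finset.Icc 1 n, partialSum c k x

/-- The Vilenkin–Fourier coefficient of a martingale `f = (f^{(k)})`. -/
def martCoeff (f : ℕ → G m → ℂ) (i : ℕ) : ℂ :=
  limUnder atTop fun k => coeff (f k) i

/-- The maximal function `f^* = sup_n |f^{(n)}|`, with values in `[0, ∞]`. -/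
def maximal (f : ℕ → G m → ℂ) (x : G m) : ℝ≥0∞ := ⨆ n, ‖f n x‖ₑ

/-- `‖f‖_{H_p} = ‖f^*‖_p = (∫ (f^*)^p dμ)^{1/p}`. -/
def hpNorm (p : ℝ) (f : ℕ → G m → ℂ) : ℝ≥0∞ :=
  (∫⁻ x, maximal f x ^ p ∂haar m) ^ (1 / p)

/-- `f ∈ H_p(G_m)`. -/
def MemHp (p : ℝ) (f : ℕ → G m → ℂ) : Prop :=
  Martingale f (filt m) (haar m) ∧ hpNorm p f < ∞

/-- The modulus of continuity `ω(1/M_N, f)_{H_p} = ‖f - S_{M_N} f‖_{H_p}`; the martingale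
`f - S_{M_N} f` has the components `f^{(k)} - S_{M_N} f^{(k)}`. -/
def modulus (p : ℝ) (f : ℕ → G m → ℂ) (N : ℕ) : ℝ≥0∞ :=
  hpNorm p fun k x => f k x - partialSum (coeff (f k)) (M m N) x

/-- `‖g‖_p = (∫ |g|^p dμ)^{1/p}` for functions. -/
def lpNorm (p : ℝ) (g : G m → ℂ) : ℝ≥0∞ :=
  (∫⁻ x, ‖g x‖ₑ ^ p ∂haar m) ^ (1 / p)

/-- `‖f‖_p = sup_k ‖f^{(k)}‖_p` for martingales. -/
def martLpNorm (p : ℝ) (f : ℕ → G m → ℂ) : ℝ≥0∞ := ⨆ k, lpNorm p (f k)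

end Vilenkin

end

/-! For `M_N ≤ n < M_{N+1}` the mean `σ_n` sees only coefficients below `M_{N+1}`, so `σ_n f = σ_n
f^{(N)} + σ_n d_N` with `d_N = f^{(N+1)} - f^{(N)}`. The two terms are treated differently, always
through `p`-th powers of `‖·‖_p`, which are subadditive.

The difference `d_N` is constant on cylinders of mass `1/M_{N+1}`. On such functions integrals are
controlled by `L_p` means at the cost of a power of `M_{N+1}` (`lintegral_rpow_le`), so a bound for
`∫ |n K_n|^p` bounds `σ_n` (`lintegral_fejer_rpow_le`). The kernel bound is a multiple of `∑_{s ≤ N}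
M_s^{2p-1}` (`exists_lintegral_fejerKernel_le`), which is bounded for `p < 1/2` and equals `N + 1`
for `p = 1/2`. Since `‖d_N‖_p` is at most the modulus at `N`, the assumed rate is exactly what makes
`‖σ_n d_N‖_p` vanish.

For `f^{(N)}` that logarithmic loss is avoided. Partial sums of index at least `M_N` reproduce
`f^{(N)}`, so its Fejér error at `n` is `M_N / n` times the error at `M_N` (`fejer_sub_self`); at
such indices the kernel bound has no sum (`exists_lintegral_fejerKernel_M_le`). Passing from `N` to
`N + 1` therefore contracts the `p`-th power of the error by `2^{-p}` and adds a multiple of `∫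
(remainder)^p`, which tends to zero (`lintegral_fejer_sub_le_geomRec`).

All bounds are uniform in the martingale component, which gives the supremum over `k`; the almost
everywhere limit follows because the remainders tend to zero in `L_p`. -/

namespace Vilenkin

variable {m : ℕ → ℕ}

/-! ### Mixed-radix digits and Vilenkin functions -/

section Digits

theorem M_pos (hm : ∀ k, 2 ≤ m k) (s : ℕ) : 0 < M m s := by
  induction s with
  | zero => simp [M]
  | succ s ih => exact Nat.mul_pos (by have := hm s; omega) ih

theorem M_mono (hm : ∀ k, 2 ≤ m k) : Monotone (M m) :=
  monotone_nat_of_le_succ fun s => Nat.le_mul_of_pos_left _ (by have := hm s; omega)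

theorem lt_M (hm : ∀ k, 2 ≤ m k) (s : ℕ) : s < M m s := by
  induction s with
  | zero => simp [M]
  | succ s ih =>
    have := hm s
    simp only [M]
    nlinarith

theorem M_dvd (m : ℕ → ℕ) {i j : ℕ} (h : i ≤ j) : M m i ∣ M m j := by
  induction j, h using Nat.le_induction with
  | base => exact dvd_rfl
  | succ j _ ih => exact ih.mul_left _

theorem two_pow_le_M (hm : ∀ k, 2 ≤ m k) (s : ℕ) : 2 ^ s ≤ M m s := by
  induction s with
  | zero => simp [M]
  | succ s ih =>
    rw [pow_succ, mul_comm]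
    exact Nat.mul_le_mul (hm s) ih

theorem digit_eq_zero_of_lt_M (hm : ∀ k, 2 ≤ m k) {n s k : ℕ} (hn : n < M m s) (hk : s ≤ k) :
    digit m n k = 0 := by
  simp [digit, Nat.div_eq_of_lt (hn.trans_le (M_mono hm hk))]

theorem psi_eq_prod (hm : ∀ k, 2 ≤ m k) {n s : ℕ} (hn : n < M m s) (x : G m) :
    psi m n x = ∏ k ∈ Finset.range s, rademacher m k x ^ digit m n k := by
  rcases le_total n s with h | h
  · refine Finset.prod_subset (Finset.range_mono h) fun k _ hk => ?_
    rw [digit_eq_zero m hm (by simpa using hk), pow_zero]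
  · refine (Finset.prod_subset (Finset.range_mono h) fun k _ hk => ?_).symm
    rw [digit_eq_zero_of_lt_M hm hn (by simpa using hk), pow_zero]

theorem psi_zero (x : G m) : psi m 0 x = 1 := by simp [psi]

theorem psi_mul_M_add (hm : ∀ k, 2 ≤ m k) {s r k : ℕ} (hr : r < m s) (hk : k < M m s) (x : G m) :
    psi m (r * M m s + k) x = rademacher m s x ^ r * psi m k x := by
  have hs := M_pos hm s
  have hlt : r * M m s + k < M m (s + 1) := by
    have : (r + 1) * M m s ≤ m s * M m s := Nat.mul_le_mul_right _ hr
    simp only [M]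
    linarith
  rw [psi_eq_prod hm hlt, psi_eq_prod hm hk, Finset.prod_range_succ, mul_comm]
  congr 1
  · congr 1
    rw [digit, mul_comm, Nat.mul_add_div hs, Nat.div_eq_of_lt hk, add_zero, Nat.mod_eq_of_lt hr]
  · refine Finset.prod_congr rfl fun j hj => ?_
    congr 1
    have hj' : j + 1 ≤ s := Finset.mem_range.1 hj
    obtain ⟨c, hc⟩ := M_dvd m hj'
    have : r * M m s + k = M m j * (m j * (r * c)) + k := by
      rw [hc]; simp only [M]; ring
    rw [digit, digit, this, Nat.mul_add_div (M_pos hm j), Nat.mul_add_mod]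

theorem psi_congr (hm : ∀ k, 2 ≤ m k) {n s : ℕ} (hn : n < M m s) {x y : G m}
    (h : y ∈ cyl m s x) : psi m n y = psi m n x := by
  rw [psi_eq_prod hm hn, psi_eq_prod hm hn]
  refine Finset.prod_congr rfl fun k hk => ?_
  rw [rademacher, rademacher, h k (Finset.mem_range.1 hk)]

end Digits

/-! ### Cylinders and character sums -/

theorem mem_cyl_comm {n : ℕ} {x y : G m} : y ∈ cyl m n x ↔ x ∈ cyl m n y :=
  ⟨fun h k hk => (h k hk).symm, fun h k hk => (h k hk).symm⟩

theorem mem_cyl_of_le {a b : ℕ} (hab : a ≤ b) {x y : G m} (h : y ∈ cyl m b x) : y ∈ cyl m a x :=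
  fun k hk => h k (hk.trans_le hab)

theorem mem_cyl_succ {s : ℕ} {x y : G m} :
    y ∈ cyl m (s + 1) x ↔ y ∈ cyl m s x ∧ y s = x s := by
  refine ⟨fun h => ⟨fun k hk => h k (by omega), h s (by omega)⟩, fun h k hk => ?_⟩
  rcases Nat.lt_succ_iff_lt_or_eq.1 hk with hk | rfl
  exacts [h.1 k hk, h.2]

/-- Extension of a finite sequence of coordinates by zero. -/
def extend (n : ℕ) (z : ∀ k : Fin n, ZMod (m k)) : G m :=
  fun k => if h : k < n then z ⟨k, h⟩ else 0

theorem mem_cyl_extend {n : ℕ} {z : ∀ k : Fin n, ZMod (m k)} {x : G m} :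
    x ∈ cyl m n (extend n z) ↔ z = fun k : Fin n => x k := by
  constructor
  · intro h
    funext k
    simpa [extend] using (h k k.2).symm
  · rintro rfl k hk
    simp [extend, hk]

variable [∀ k, NeZero (m k)]

theorem norm_rademacher (k : ℕ) (x : G m) : ‖rademacher m k x‖ = 1 := by
  have : rademacher m k x = ((ZMod.toCircle (x k) : Circle) : ℂ) := by
    rw [ZMod.toCircle_apply]; rfl
  rw [this, Circle.norm_coe]

theorem norm_psi (n : ℕ) (x : G m) : ‖psi m n x‖ = 1 := by
  simp [psi, norm_prod, norm_pow, norm_rademacher]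

theorem measurable_psi (n : ℕ) : Measurable (psi m n) := by
  refine Finset.measurable_prod _ fun k _ => Measurable.pow_const ?_ _
  exact (measurable_of_countable
    (fun z : ZMod (m k) => Complex.exp (2 * Real.pi * Complex.I * (z.val : ℂ) / (m k : ℂ)))).comp
    (measurable_pi_apply k)

/-- The product `r_s(x) * conj (r_s(t))`. -/
noncomputable def ratio (m : ℕ → ℕ) (s : ℕ) (x t : G m) : ℂ :=
  rademacher m s x * (starRingEnd ℂ) (rademacher m s t)

theorem norm_ratio (s : ℕ) (x t : G m) : ‖ratio m s x t‖ = 1 := by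
  simp [ratio, norm_rademacher]

-- The ratio is the value at `x_s - t_s` of a faithful character of `ℤ / m_s`, so a full geometric
-- sum detects equality of the `s`-th coordinates.
open Classical in
theorem sum_ratio_pow (s : ℕ) (x t : G m) :
    ∑ r ∈ Finset.range (m s), ratio m s x t ^ r = if x s = t s then (m s : ℂ) else 0 := by
  have h (y : G m) : rademacher m s y = ZMod.stdAddChar (y s) := by
    rw [ZMod.stdAddChar_apply, ZMod.toCircle_apply]; rfl
  have hw : ratio m s x t = ZMod.stdAddChar (x s - t s) := by
    rw [ratio, h, h, AddChar.map_sub_eq_div, div_eq_mul_inv, ← h t,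
      Complex.inv_eq_conj (norm_rademacher s t)]
  split_ifs with hx
  · simp [hw, hx]
  · have h1 : ratio m s x t ≠ 1 := by
      rw [hw, ← AddChar.map_zero_eq_one (ZMod.stdAddChar (N := m s))]
      exact fun h => hx (sub_eq_zero.1 (ZMod.injective_stdAddChar h))
    have h2 : ratio m s x t ^ m s = 1 := by
      rw [hw, ← AddChar.map_nsmul_eq_pow]; simp
    rw [geom_sum_eq h1, h2, sub_self, zero_div]

/-! ### Haar measure and functions constant on cylinders -/

section Haar

instance : IsProbabilityMeasure (haar m) := by
  unfold haar; infer_instance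

theorem haar_cyl (n : ℕ) (x : G m) : haar m (cyl m n x) = (M m n : ℝ≥0∞)⁻¹ := by
  have : cyl m n x = Set.pi (Finset.range n : Set ℕ) fun k => {x k} := by
    ext y; simp [cyl, Set.mem_pi]
  rw [this, haar, Measure.infinitePi_pi _ fun k _ => MeasurableSet.singleton _]
  have h1 (k : ℕ) : uniformOn (Set.univ : Set (ZMod (m k))) {x k} = (m k : ℝ≥0∞)⁻¹ := by
    rw [uniformOn_univ]; simp [ZMod.card]
  simp only [h1]
  clear this
  induction n with
  | zero => simp [M]
  | succ n ih =>
    rw [Finset.prod_range_succ, ih, M, Nat.cast_mul, mul_comm,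
      ENNReal.mul_inv (by simp) (by simp)]

theorem eq_sum_indicator {E : Type*} [AddCommMonoid E] {n : ℕ} {h : G m → E}
    (hh : ∀ x, ∀ y ∈ cyl m n x, h y = h x) (x : G m) :
    h x = ∑ z : (∀ k : Fin n, ZMod (m k)),
      (cyl m n (extend n z)).indicator (fun _ => h (extend n z)) x := by
  rw [Finset.sum_eq_single (fun k : Fin n => x k)]
  · have hx : x ∈ cyl m n (extend n fun k : Fin n => x k) := mem_cyl_extend.2 rfl
    rw [Set.indicator_of_mem hx, hh _ _ hx]
  · intro z _ hz
    exact Set.indicator_of_notMem (fun hx => hz (mem_cyl_extend.1 hx)) _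
  · simp

theorem measurable_of_const_on_cyl {E : Type*} [AddCommMonoid E] [MeasurableSpace E]
    [MeasurableAdd₂ E] {n : ℕ} {h : G m → E}
    (hh : ∀ x, ∀ y ∈ cyl m n x, h y = h x) : Measurable h := by
  rw [funext (eq_sum_indicator hh)]
  exact Finset.measurable_sum _ fun z _ => measurable_const.indicator (measurableSet_cyl m n _)

theorem lintegral_eq_sum {n : ℕ} {h : G m → ℝ≥0∞} (hh : ∀ x, ∀ y ∈ cyl m n x, h y = h x) :
    ∫⁻ x, h x ∂haar m = ∑ z : (∀ k : Fin n, ZMod (m k)), h (extend n z) * (M m n : ℝ≥0∞)⁻¹ := by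
  rw [lintegral_congr (eq_sum_indicator hh),
    lintegral_finsetSum _ fun z _ => measurable_const.indicator (measurableSet_cyl m n _)]
  refine Finset.sum_congr rfl fun z _ => ?_
  rw [lintegral_indicator (measurableSet_cyl m n _), lintegral_const, Measure.restrict_apply_univ,
    haar_cyl]

-- The coordinate `x_s` is uniform and independent of the first `s` coordinates.
open Classical in
theorem lintegral_ite_coord {s : ℕ} {h : G m → ℝ≥0∞} (hh : ∀ x, ∀ y ∈ cyl m s x, h y = h x)
    (a : ZMod (m s)) :
    ∫⁻ x, (if x s = a then h x else 0) ∂haar m = (m s : ℝ≥0∞)⁻¹ * ∫⁻ x, h x ∂haar m := by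
  rw [lintegral_eq_sum hh, Finset.mul_sum]
  have key (x : G m) : (if x s = a then h x else 0) = ∑ z : (∀ k : Fin s, ZMod (m k)),
      (cyl m (s + 1) (Function.update (extend s z) s a)).indicator
        (fun _ => h (extend s z)) x := by
    have hmem (z : ∀ k : Fin s, ZMod (m k)) :
        x ∈ cyl m (s + 1) (Function.update (extend s z) s a) ↔
          x ∈ cyl m s (extend s z) ∧ x s = a := by
      rw [mem_cyl_succ, Function.update_self]
      refine and_congr_left fun _ => forall₂_congr fun k hk => ?_
      rw [Function.update_of_ne hk.ne]
    split_ifs with hx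
    · rw [eq_sum_indicator hh x]
      refine Finset.sum_congr rfl fun z _ => ?_
      simp only [Set.indicator, hmem, hx, and_true]
    · refine (Finset.sum_eq_zero fun z _ => Set.indicator_of_notMem ?_ _).symm
      exact fun h => hx ((hmem z).1 h).2
  simp_rw [key]
  rw [lintegral_finsetSum _ fun z _ => measurable_const.indicator (measurableSet_cyl m _ _)]
  refine Finset.sum_congr rfl fun z _ => ?_
  rw [lintegral_indicator (measurableSet_cyl m _ _), lintegral_const, Measure.restrict_apply_univ,
    haar_cyl, M, Nat.cast_mul, ENNReal.mul_inv (by simp) (by simp)]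
  ring

theorem rpow_sum_le {ι : Type*} (s : Finset ι) (a : ι → ℝ≥0∞) {p : ℝ} (hp0 : 0 < p)
    (hp1 : p ≤ 1) : (∑ i ∈ s, a i) ^ p ≤ ∑ i ∈ s, a i ^ p := by
  classical
  induction s using Finset.induction_on with
  | empty => simp [hp0]
  | insert i s hi ih =>
    rw [Finset.sum_insert hi, Finset.sum_insert hi]
    exact (ENNReal.rpow_add_le_add_rpow _ _ hp0.le hp1).trans (by gcongr)

/-- A reverse Hölder inequality: the integral is a finite sum of values times `1 / M_n`, the power
`p ≤ 1` is subadditive, and the factor `M_n^{1-p}` compares `M_n^{-p}` with `M_n^{-1}`. -/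
theorem lintegral_rpow_le (hm : ∀ k, 2 ≤ m k) {n : ℕ} {h : G m → ℝ≥0∞}
    (hh : ∀ x, ∀ y ∈ cyl m n x, h y = h x)
    {p : ℝ} (hp0 : 0 < p) (hp1 : p ≤ 1) :
    (∫⁻ x, h x ∂haar m) ^ p ≤ (M m n : ℝ≥0∞) ^ (1 - p) * ∫⁻ x, h x ^ p ∂haar m := by
  rw [lintegral_eq_sum hh, lintegral_eq_sum (n := n) (h := fun x => h x ^ p)
    (fun x y hy => by simp only [hh x y hy])]
  refine (rpow_sum_le _ _ hp0 hp1).trans_eq ?_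
  rw [Finset.mul_sum]
  refine Finset.sum_congr rfl fun z _ => ?_
  have hM : (M m n : ℝ≥0∞) ≠ 0 := by exact_mod_cast (M_pos hm n).ne'
  have : (M m n : ℝ≥0∞) ^ (1 - p) * (M m n : ℝ≥0∞)⁻¹ = (M m n : ℝ≥0∞)⁻¹ ^ p := by
    rw [ENNReal.inv_rpow, ← ENNReal.rpow_neg, ← ENNReal.rpow_neg_one,
      ← ENNReal.rpow_add _ _ hM (by simp)]
    congr 1; ring
  rw [ENNReal.mul_rpow_of_nonneg _ _ hp0.le, ← this]
  ring

end Haar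

end Vilenkin

namespace Vilenkin

variable {m : ℕ → ℕ}

/-! ### Pointwise recursion for Dirichlet and Fejér kernels -/

section Kernels

/-- The Dirichlet kernel `D_n(x - t) = ∑_{k<n} ψ_k(x) conj (ψ_k(t))`. -/
noncomputable def dirichletKernel (m : ℕ → ℕ) (n : ℕ) (x t : G m) : ℂ :=
  ∑ k ∈ Finset.range n, psi m k x * (starRingEnd ℂ) (psi m k t)

/-- The unnormalized Fejér kernel `n K_n(x - t) = ∑_{k=1}^n D_k(x - t)`. -/
noncomputable def fejerKernel (m : ℕ → ℕ) (n : ℕ) (x t : G m) : ℂ :=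
  ∑ k ∈ Finset.range n, dirichletKernel m (k + 1) x t

theorem dirichletKernel_mul_M_add (hm : ∀ k, 2 ≤ m k) {s r k : ℕ} (hr : r < m s)
    (hk : k ≤ M m s) (x t : G m) :
    dirichletKernel m (r * M m s + k) x t =
      dirichletKernel m (r * M m s) x t + ratio m s x t ^ r * dirichletKernel m k x t := by
  simp only [dirichletKernel]
  rw [Finset.sum_range_add, Finset.mul_sum]
  congr 1
  refine Finset.sum_congr rfl fun j hj => ?_
  have hj' := (Finset.mem_range.1 hj).trans_le hk
  rw [psi_mul_M_add hm hr hj', psi_mul_M_add hm hr hj', ratio, map_mul, map_pow, mul_pow]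
  ring

theorem dirichletKernel_mul_M (hm : ∀ k, 2 ≤ m k) {s r : ℕ} (hr : r ≤ m s) (x t : G m) :
    dirichletKernel m (r * M m s) x t =
      (∑ q ∈ Finset.range r, ratio m s x t ^ q) * dirichletKernel m (M m s) x t := by
  induction r with
  | zero => simp [dirichletKernel]
  | succ r ih =>
    rw [Nat.succ_mul, dirichletKernel_mul_M_add hm hr le_rfl, ih (by omega),
      Finset.sum_range_succ]
    ring

theorem fejerKernel_mul_M_add (hm : ∀ k, 2 ≤ m k) {s r k : ℕ} (hr : r < m s)
    (hk : k ≤ M m s) (x t : G m) :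
    fejerKernel m (r * M m s + k) x t = fejerKernel m (r * M m s) x t +
      k * dirichletKernel m (r * M m s) x t + ratio m s x t ^ r * fejerKernel m k x t := by
  simp only [fejerKernel]
  rw [Finset.sum_range_add, Finset.mul_sum, add_assoc]
  congr 1
  have : ∀ j ∈ Finset.range k, dirichletKernel m (r * M m s + j + 1) x t =
      dirichletKernel m (r * M m s) x t + ratio m s x t ^ r * dirichletKernel m (j + 1) x t :=
    fun j hj => dirichletKernel_mul_M_add hm hr ((Finset.mem_range.1 hj).trans_le hk) x t
  rw [Finset.sum_congr rfl this, Finset.sum_add_distrib]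
  simp

theorem fejerKernel_mul_M (hm : ∀ k, 2 ≤ m k) {s r : ℕ} (hr : r ≤ m s) (x t : G m) :
    fejerKernel m (r * M m s) x t =
      ∑ q ∈ Finset.range r, M m s * dirichletKernel m (q * M m s) x t +
      (∑ q ∈ Finset.range r, ratio m s x t ^ q) * fejerKernel m (M m s) x t := by
  induction r with
  | zero => simp [fejerKernel]
  | succ r ih =>
    rw [Nat.succ_mul, fejerKernel_mul_M_add hm hr le_rfl, ih (by omega),
      Finset.sum_range_succ, Finset.sum_range_succ]
    ring

theorem dirichletKernel_congr_left (hm : ∀ k, 2 ≤ m k) {n s : ℕ} (hn : n ≤ M m s)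
    {x y : G m} (h : y ∈ cyl m s x) (t : G m) :
    dirichletKernel m n y t = dirichletKernel m n x t :=
  Finset.sum_congr rfl fun k hk => by
    rw [psi_congr hm ((Finset.mem_range.1 hk).trans_le hn) h]

theorem dirichletKernel_congr_right (hm : ∀ k, 2 ≤ m k) {n s : ℕ} (hn : n ≤ M m s)
    {t y : G m} (h : y ∈ cyl m s t) (x : G m) :
    dirichletKernel m n x y = dirichletKernel m n x t :=
  Finset.sum_congr rfl fun k hk => by
    rw [psi_congr hm ((Finset.mem_range.1 hk).trans_le hn) h]

theorem fejerKernel_congr_left (hm : ∀ k, 2 ≤ m k) {n s : ℕ} (hn : n ≤ M m s)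
    {x y : G m} (h : y ∈ cyl m s x) (t : G m) :
    fejerKernel m n y t = fejerKernel m n x t :=
  Finset.sum_congr rfl fun _ hk => dirichletKernel_congr_left hm
    (Nat.succ_le_of_lt ((Finset.mem_range.1 hk).trans_le hn)) h t

theorem fejerKernel_congr_right (hm : ∀ k, 2 ≤ m k) {n s : ℕ} (hn : n ≤ M m s)
    {t y : G m} (h : y ∈ cyl m s t) (x : G m) :
    fejerKernel m n x y = fejerKernel m n x t :=
  Finset.sum_congr rfl fun _ hk => dirichletKernel_congr_right hm
    (Nat.succ_le_of_lt ((Finset.mem_range.1 hk).trans_le hn)) h x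

variable [∀ k, NeZero (m k)]

theorem measurable_fejerKernel (n : ℕ) :
    Measurable fun q : G m × G m => fejerKernel m n q.1 q.2 := by
  refine Finset.measurable_sum _ fun k _ => Finset.measurable_sum _ fun j _ => ?_
  exact ((measurable_psi j).comp measurable_fst).mul
    (Complex.continuous_conj.measurable.comp ((measurable_psi j).comp measurable_snd))

theorem dirichletKernel_M (hm : ∀ k, 2 ≤ m k) (s : ℕ) (x t : G m) :
    dirichletKernel m (M m s) x t = (cyl m s t).indicator (fun _ => (M m s : ℂ)) x := by
  classical
  induction s with
  | zero => simp [dirichletKernel, M, psi_zero, cyl]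
  | succ s ih =>
    rw [M, dirichletKernel_mul_M hm le_rfl, sum_ratio_pow, ih]
    simp only [Set.indicator, mem_cyl_succ]
    by_cases h1 : x s = t s <;> by_cases h2 : x ∈ cyl m s t <;> simp [h1, h2]

theorem enorm_sum_ratio_pow_le (s r : ℕ) (x t : G m) :
    ‖∑ q ∈ Finset.range r, ratio m s x t ^ q‖ₑ ≤ r := by
  refine (enorm_sum_le _ _).trans ?_
  have (q : ℕ) : ‖ratio m s x t ^ q‖ₑ = 1 := by
    rw [enorm_pow, ← ofReal_norm, norm_ratio]; simp
  simp [this]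

theorem enorm_M_mul_dirichletKernel_le (hm : ∀ k, 2 ≤ m k) {s r : ℕ} (hr : r ≤ m s)
    (x t : G m) : (M m s : ℝ≥0∞) * ‖dirichletKernel m (r * M m s) x t‖ₑ ≤
      r * (cyl m s t).indicator (fun _ => (M m s : ℝ≥0∞) ^ 2) x := by
  rw [dirichletKernel_mul_M hm hr, dirichletKernel_M hm, enorm_mul]
  by_cases h : x ∈ cyl m s t
  · simp only [h, Set.indicator_of_mem]
    calc _ ≤ (M m s : ℝ≥0∞) * (r * M m s) := by
          gcongr
          · exact enorm_sum_ratio_pow_le s r x t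
          · rw [← ofReal_norm]; simp
      _ = _ := by ring
  · simp [h]

theorem enorm_sum_M_mul_dirichletKernel_le (hm : ∀ k, 2 ≤ m k) {s r : ℕ} (hr : r ≤ m s)
    (x t : G m) : ‖∑ q ∈ Finset.range r, (M m s : ℂ) * dirichletKernel m (q * M m s) x t‖ₑ ≤
      (m s : ℝ≥0∞) ^ 2 * (cyl m s t).indicator (fun _ => (M m s : ℝ≥0∞) ^ 2) x := by
  refine (enorm_sum_le _ _).trans ?_
  calc _ ≤ ∑ q ∈ Finset.range r,
        (m s : ℝ≥0∞) * (cyl m s t).indicator (fun _ => (M m s : ℝ≥0∞) ^ 2) x := by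
        refine Finset.sum_le_sum fun q hq => ?_
        have hq' : q ≤ m s := (Finset.mem_range.1 hq).le.trans hr
        rw [enorm_mul]
        calc _ = (M m s : ℝ≥0∞) * ‖dirichletKernel m (q * M m s) x t‖ₑ := by
              rw [← ofReal_norm (M m s : ℂ)]; simp
          _ ≤ _ := enorm_M_mul_dirichletKernel_le hm hq' x t
          _ ≤ _ := by gcongr
    _ = (r : ℝ≥0∞) *
        ((m s : ℝ≥0∞) * (cyl m s t).indicator (fun _ => (M m s : ℝ≥0∞) ^ 2) x) := by simp
    _ ≤ (m s : ℝ≥0∞) *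
        ((m s : ℝ≥0∞) * (cyl m s t).indicator (fun _ => (M m s : ℝ≥0∞) ^ 2) x) := by gcongr
    _ = _ := by ring

-- The full geometric sum kills the old kernel off `x_s = t_s`. Keeping this restriction, rather
-- than estimating the sum by `m_s`, is what later yields a bound without a logarithm.
open Classical in
theorem enorm_fejerKernel_M_succ_le (hm : ∀ k, 2 ≤ m k) (s : ℕ) (x t : G m) :
    ‖fejerKernel m (M m (s + 1)) x t‖ₑ ≤
      (m s : ℝ≥0∞) ^ 2 * (cyl m s t).indicator (fun _ => (M m s : ℝ≥0∞) ^ 2) x +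
      if x s = t s then m s * ‖fejerKernel m (M m s) x t‖ₑ else 0 := by
  rw [M, fejerKernel_mul_M hm le_rfl, sum_ratio_pow]
  refine (enorm_add_le _ _).trans (add_le_add
    (enorm_sum_M_mul_dirichletKernel_le hm le_rfl x t) (le_of_eq ?_))
  split_ifs
  · rw [enorm_mul, ← ofReal_norm (m s : ℂ)]; simp
  · simp

/-- Splitting off the leading digit, `n = r M_s + k`. The kernel of the tail `k` reappears with
coefficient one, so iteration adds up one contribution per level. -/
theorem enorm_fejerKernel_le (hm : ∀ k, 2 ≤ m k) {s n : ℕ} (hn : n < M m (s + 1)) (x t : G m) :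
    ‖fejerKernel m n x t‖ₑ ≤
      ((m s : ℝ≥0∞) ^ 2 + m s) * (cyl m s t).indicator (fun _ => (M m s : ℝ≥0∞) ^ 2) x +
      m s * ‖fejerKernel m (M m s) x t‖ₑ + ‖fejerKernel m (n % M m s) x t‖ₑ := by
  have hs := M_pos hm s
  have hr : n / M m s < m s := (Nat.div_lt_iff_lt_mul hs).2 hn
  have hk : n % M m s < M m s := Nat.mod_lt _ hs
  conv_lhs => rw [← Nat.div_add_mod' n (M m s), fejerKernel_mul_M_add hm hr hk.le,
    fejerKernel_mul_M hm hr.le]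
  set r := n / M m s
  set k := n % M m s
  calc _ ≤ ‖∑ q ∈ Finset.range r, (M m s : ℂ) * dirichletKernel m (q * M m s) x t‖ₑ +
        ‖(∑ q ∈ Finset.range r, ratio m s x t ^ q) * fejerKernel m (M m s) x t‖ₑ +
        ‖(k : ℂ) * dirichletKernel m (r * M m s) x t‖ₑ +
        ‖ratio m s x t ^ r * fejerKernel m k x t‖ₑ := by
        refine (enorm_add_le _ _).trans ?_
        gcongr
        refine (enorm_add_le _ _).trans ?_
        gcongr
        exact enorm_add_le _ _
    _ ≤ (m s : ℝ≥0∞) ^ 2 * (cyl m s t).indicator (fun _ => (M m s : ℝ≥0∞) ^ 2) x +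
        m s * ‖fejerKernel m (M m s) x t‖ₑ +
        m s * (cyl m s t).indicator (fun _ => (M m s : ℝ≥0∞) ^ 2) x +
        ‖fejerKernel m k x t‖ₑ := by
        gcongr ?_ + ?_ + ?_ + ?_
        · exact enorm_sum_M_mul_dirichletKernel_le hm hr.le x t
        · rw [enorm_mul]
          gcongr
          exact (enorm_sum_ratio_pow_le s r x t).trans (by exact_mod_cast hr.le)
        · rw [enorm_mul]
          calc _ ≤ (M m s : ℝ≥0∞) * ‖dirichletKernel m (r * M m s) x t‖ₑ := by
                gcongr
                rw [← ofReal_norm]; simpa using hk.le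
            _ ≤ _ := enorm_M_mul_dirichletKernel_le hm hr.le x t
            _ ≤ _ := by gcongr
        · rw [enorm_mul, enorm_pow, ← ofReal_norm, norm_ratio]; simp
    _ = _ := by ring

end Kernels

/-! ### Integrals of `p`-th powers of the Fejér kernels -/

section KernelIntegrals

theorem measurable_indicator_rpow (p : ℝ) (c : ℝ≥0∞) (s : ℕ) (t : G m) :
    Measurable fun x => ((cyl m s t).indicator (fun _ => c) x) ^ p :=
  (measurable_const.indicator (measurableSet_cyl m s t)).pow_const p

variable [∀ k, NeZero (m k)]

theorem lintegral_indicator_rpow (hm : ∀ k, 2 ≤ m k) {p : ℝ} (hp0 : 0 < p) (s : ℕ) (t : G m) :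
    ∫⁻ x, ((cyl m s t).indicator (fun _ => (M m s : ℝ≥0∞) ^ 2) x) ^ p ∂haar m =
      (M m s : ℝ≥0∞) ^ (2 * p - 1) := by
  have hM : (M m s : ℝ≥0∞) ≠ 0 := by exact_mod_cast (M_pos hm s).ne'
  have (x : G m) : ((cyl m s t).indicator (fun _ => (M m s : ℝ≥0∞) ^ 2) x) ^ p =
      (cyl m s t).indicator (fun _ => (M m s : ℝ≥0∞) ^ (2 * p)) x := by
    by_cases h : x ∈ cyl m s t
    · simp only [h, Set.indicator_of_mem]
      rw [ENNReal.rpow_mul]; simp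
    · simp [h, hp0]
  simp_rw [this]
  rw [lintegral_indicator (measurableSet_cyl m s t), lintegral_const,
    Measure.restrict_apply_univ, haar_cyl, ← ENNReal.rpow_neg_one,
    ← ENNReal.rpow_add _ _ hM (by simp)]
  rfl

-- The condition `x_s = t_s` has probability `1 / m_s` independently of the old kernel, which turns
-- the factor `m_s^p` into `m_s^{p-1}`.
open Classical in
theorem lintegral_fejerKernel_M_succ_le (hm : ∀ k, 2 ≤ m k) {p : ℝ} (hp0 : 0 < p) (hp1 : p ≤ 1)
    (s : ℕ) (t : G m) :
    ∫⁻ x, ‖fejerKernel m (M m (s + 1)) x t‖ₑ ^ p ∂haar m ≤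
      ((m s : ℝ≥0∞) ^ 2) ^ p * (M m s : ℝ≥0∞) ^ (2 * p - 1) +
      (m s : ℝ≥0∞) ^ (p - 1) * ∫⁻ x, ‖fejerKernel m (M m s) x t‖ₑ ^ p ∂haar m := by
  have hconst : ∀ x, ∀ y ∈ cyl m s x, (m s : ℝ≥0∞) ^ p * ‖fejerKernel m (M m s) y t‖ₑ ^ p =
      (m s : ℝ≥0∞) ^ p * ‖fejerKernel m (M m s) x t‖ₑ ^ p := fun x y hy => by
    rw [fejerKernel_congr_left hm le_rfl hy]
  calc _ ≤ ∫⁻ x, (((m s : ℝ≥0∞) ^ 2) ^ p *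
          ((cyl m s t).indicator (fun _ => (M m s : ℝ≥0∞) ^ 2) x) ^ p +
        if x s = t s then (m s : ℝ≥0∞) ^ p * ‖fejerKernel m (M m s) x t‖ₑ ^ p else 0) ∂haar m := by
        refine lintegral_mono fun x => ?_
        refine (ENNReal.rpow_le_rpow (enorm_fejerKernel_M_succ_le hm s x t) hp0.le).trans ?_
        refine (ENNReal.rpow_add_le_add_rpow _ _ hp0.le hp1).trans ?_
        rw [ENNReal.mul_rpow_of_nonneg _ _ hp0.le]
        gcongr
        split_ifs
        · rw [ENNReal.mul_rpow_of_nonneg _ _ hp0.le]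
        · simp [hp0]
    _ = _ := by
        rw [lintegral_add_left ((measurable_indicator_rpow p _ s t).const_mul _),
          lintegral_const_mul _ (measurable_indicator_rpow p _ s t),
          lintegral_indicator_rpow hm hp0, lintegral_ite_coord hconst, lintegral_const_mul',
          ← mul_assoc]
        · congr 2
          rw [← ENNReal.rpow_neg_one, ← ENNReal.rpow_add _ _ (by simp [NeZero.ne]) (by simp)]
          congr 1; ring
        · exact ENNReal.rpow_ne_top_of_nonneg hp0.le (by simp)

theorem natCast_rpow_eq_ofReal {n : ℕ} (hn : 0 < n) (a : ℝ) :
    (n : ℝ≥0∞) ^ a = ENNReal.ofReal ((n : ℝ) ^ a) := by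
  rw [← ENNReal.ofReal_rpow_of_pos (by exact_mod_cast hn), ENNReal.ofReal_natCast]

/-- `B` is the constant for which a bound `B M_s^{2p-1}` propagates from `s` to `s + 1`. There is
room because `n^{2p-1}` exceeds `n^{p-1}` by the factor `n^p ≥ 2^p > 1`. -/
theorem exists_const_recursion {p : ℝ} (hp0 : 0 < p) (C : ℕ) :
    ∃ B : ℝ≥0∞, B ≠ ∞ ∧ 1 ≤ B ∧ ∀ n : ℕ, 2 ≤ n → n ≤ C →
      ((n : ℝ≥0∞) ^ 2) ^ p + (n : ℝ≥0∞) ^ (p - 1) * B ≤ B * (n : ℝ≥0∞) ^ (2 * p - 1) := by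
  have h2 : (1 : ℝ) < 2 ^ p := Real.one_lt_rpow one_lt_two hp0
  set K : ℝ := ((C : ℝ) ^ 2) ^ p with hK
  -- The quotient absorbs the inhomogeneous term; the lower bound 1 serves the initial kernel, which
  -- is identically 1.
  set B : ℝ := max 1 (K * C / (2 ^ p - 1)) with hB
  have hK0 : 0 ≤ K := by positivity
  have hB1 : 1 ≤ B := le_max_left _ _
  refine ⟨ENNReal.ofReal B, ENNReal.ofReal_ne_top, by simpa using hB1, fun n hn hnC => ?_⟩
  have hn0 : 0 < n := by omega
  have hn0' : (0 : ℝ) < n := by exact_mod_cast hn0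
  have hnC' : (n : ℝ) ≤ C := by exact_mod_cast hnC
  have hn2 : ((n : ℝ≥0∞) ^ 2) ^ p = ENNReal.ofReal (((n : ℝ) ^ 2) ^ p) := by
    rw [← ENNReal.ofReal_rpow_of_pos (by positivity), ENNReal.ofReal_pow hn0'.le,
      ENNReal.ofReal_natCast]
  rw [hn2, natCast_rpow_eq_ofReal hn0, natCast_rpow_eq_ofReal hn0,
    ← ENNReal.ofReal_mul (by positivity), ← ENNReal.ofReal_mul (by positivity),
    ← ENNReal.ofReal_add (by positivity) (by positivity)]
  refine ENNReal.ofReal_le_ofReal ?_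
  have e1 : (n : ℝ) ^ (2 * p - 1) = (n : ℝ) ^ (p - 1) * (n : ℝ) ^ p := by
    rw [← Real.rpow_add hn0']; congr 1; ring
  have e2 : ((n : ℝ) ^ 2) ^ p ≤ K := by rw [hK]; gcongr
  have e3 : (2 : ℝ) ^ p ≤ (n : ℝ) ^ p := by
    gcongr; exact_mod_cast hn
  have e4 : 1 ≤ C * (n : ℝ) ^ (p - 1) := by
    calc (1 : ℝ) ≤ (n : ℝ) ^ p := by linarith
      _ = n * (n : ℝ) ^ (p - 1) := by
        rw [← Real.rpow_one_add' hn0'.le (by linarith)]; congr 1; ring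
      _ ≤ _ := by gcongr
  have e5 : K * C ≤ B * (2 ^ p - 1) := by
    rw [← div_le_iff₀ (by linarith)]; exact le_max_right _ _
  set y := (n : ℝ) ^ (p - 1)
  have hy : 0 ≤ y := by positivity
  rw [e1]
  have : K ≤ B * y * ((n : ℝ) ^ p - 1) := by
    calc K ≤ K * (C * y) := le_mul_of_one_le_right hK0 e4
      _ = K * C * y := by ring
      _ ≤ B * (2 ^ p - 1) * y := by gcongr
      _ = B * y * (2 ^ p - 1) := by ring
      _ ≤ _ := by gcongr
  linarith

theorem exists_lintegral_fejerKernel_M_le (hm : ∀ k, 2 ≤ m k) {C : ℕ} (hC : ∀ k, m k ≤ C)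
    {p : ℝ} (hp0 : 0 < p) (hp1 : p ≤ 1) :
    ∃ B : ℝ≥0∞, B ≠ ∞ ∧ ∀ s t, ∫⁻ x, ‖fejerKernel m (M m s) x t‖ₑ ^ p ∂haar m ≤
      B * (M m s : ℝ≥0∞) ^ (2 * p - 1) := by
  obtain ⟨B, hB, hB1, hrec⟩ := exists_const_recursion hp0 C
  refine ⟨B, hB, fun s t => ?_⟩
  induction s with
  | zero => simpa [fejerKernel, dirichletKernel, M, psi_zero] using hB1
  | succ s ih =>
    refine (lintegral_fejerKernel_M_succ_le hm hp0 hp1 s t).trans ?_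
    calc _ ≤ ((m s : ℝ≥0∞) ^ 2) ^ p * (M m s : ℝ≥0∞) ^ (2 * p - 1) +
          (m s : ℝ≥0∞) ^ (p - 1) * (B * (M m s : ℝ≥0∞) ^ (2 * p - 1)) := by gcongr
      _ = (((m s : ℝ≥0∞) ^ 2) ^ p + (m s : ℝ≥0∞) ^ (p - 1) * B) *
          (M m s : ℝ≥0∞) ^ (2 * p - 1) := by ring
      _ ≤ B * (m s : ℝ≥0∞) ^ (2 * p - 1) * (M m s : ℝ≥0∞) ^ (2 * p - 1) := by
          gcongr; exact hrec _ (hm s) (hC s)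
      _ = _ := by
          rw [M, Nat.cast_mul, ENNReal.mul_rpow_of_ne_top (by simp) (by simp), mul_assoc]

theorem exists_lintegral_fejerKernel_le (hm : ∀ k, 2 ≤ m k) {C : ℕ} (hC : ∀ k, m k ≤ C)
    {p : ℝ} (hp0 : 0 < p) (hp1 : p ≤ 1) :
    ∃ B : ℝ≥0∞, B ≠ ∞ ∧ ∀ N n t, n < M m N → ∫⁻ x, ‖fejerKernel m n x t‖ₑ ^ p ∂haar m ≤
      B * ∑ s ∈ Finset.range N, (M m s : ℝ≥0∞) ^ (2 * p - 1) := by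
  obtain ⟨B, hB, hle⟩ := exists_lintegral_fejerKernel_M_le hm hC hp0 hp1
  -- The cost of one level: the indicator term plus the kernel of index `M_s`, with `m_s ≤ C`.
  refine ⟨((C : ℝ≥0∞) ^ 2 + C) ^ p + (C : ℝ≥0∞) ^ p * B, ?_, fun N => ?_⟩
  · exact ENNReal.add_ne_top.2 ⟨ENNReal.rpow_ne_top_of_nonneg hp0.le (by finiteness),
      ENNReal.mul_ne_top (ENNReal.rpow_ne_top_of_nonneg hp0.le (by simp)) hB⟩
  induction N with
  | zero =>
    intro n t hn
    obtain rfl : n = 0 := by simpa [M] using hn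
    simp [fejerKernel, hp0]
  | succ s ih =>
    intro n t hn
    have hmeas : Measurable fun x => ‖fejerKernel m (M m s) x t‖ₑ ^ p :=
      ((measurable_fejerKernel (M m s)).comp measurable_prodMk_right).enorm.pow_const p
    have hmC : (m s : ℝ≥0∞) ≤ C := by exact_mod_cast hC s
    calc _ ≤ ∫⁻ x, (((C : ℝ≥0∞) ^ 2 + C) ^ p *
            ((cyl m s t).indicator (fun _ => (M m s : ℝ≥0∞) ^ 2) x) ^ p +
          (C : ℝ≥0∞) ^ p * ‖fejerKernel m (M m s) x t‖ₑ ^ p +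
          ‖fejerKernel m (n % M m s) x t‖ₑ ^ p) ∂haar m := by
          refine lintegral_mono fun x => ?_
          refine (ENNReal.rpow_le_rpow (enorm_fejerKernel_le hm hn x t) hp0.le).trans ?_
          refine (ENNReal.rpow_add_le_add_rpow _ _ hp0.le hp1).trans ?_
          gcongr
          refine (ENNReal.rpow_add_le_add_rpow _ _ hp0.le hp1).trans ?_
          rw [ENNReal.mul_rpow_of_nonneg _ _ hp0.le, ENNReal.mul_rpow_of_nonneg _ _ hp0.le]
          gcongr
      _ = ((C : ℝ≥0∞) ^ 2 + C) ^ p * (M m s : ℝ≥0∞) ^ (2 * p - 1) +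
          (C : ℝ≥0∞) ^ p * ∫⁻ x, ‖fejerKernel m (M m s) x t‖ₑ ^ p ∂haar m +
          ∫⁻ x, ‖fejerKernel m (n % M m s) x t‖ₑ ^ p ∂haar m := by
          rw [lintegral_add_left, lintegral_add_left, lintegral_const_mul, lintegral_const_mul,
            lintegral_indicator_rpow hm hp0]
          · exact hmeas
          · exact measurable_indicator_rpow p _ s t
          · exact (measurable_indicator_rpow p _ s t).const_mul _
          · exact ((measurable_indicator_rpow p _ s t).const_mul _).add (hmeas.const_mul _)
      _ ≤ ((C : ℝ≥0∞) ^ 2 + C) ^ p * (M m s : ℝ≥0∞) ^ (2 * p - 1) +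
          (C : ℝ≥0∞) ^ p * (B * (M m s : ℝ≥0∞) ^ (2 * p - 1)) +
          (((C : ℝ≥0∞) ^ 2 + C) ^ p + (C : ℝ≥0∞) ^ p * B) *
            ∑ s ∈ Finset.range s, (M m s : ℝ≥0∞) ^ (2 * p - 1) := by
          gcongr
          · exact hle s t
          · exact ih _ t (Nat.mod_lt _ (M_pos hm s))
      _ = _ := by rw [Finset.sum_range_succ]; ring

end KernelIntegrals

end Vilenkin

namespace Vilenkin

variable {m : ℕ → ℕ}

theorem fejer_eq_sum_range (c : ℕ → ℂ) (n : ℕ) (x : G m) :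
    fejer c n x = (1 / (n : ℂ)) * ∑ k ∈ Finset.range n, partialSum c (k + 1) x := by
  rw [fejer, Finset.range_eq_Ico, Finset.sum_Ico_add' (fun k => partialSum c k x) 0 n 1]
  rfl

theorem fejer_congr {c d : ℕ → ℂ} {n : ℕ} (h : ∀ i < n, c i = d i) (x : G m) :
    fejer c n x = fejer d n x := by
  simp only [fejer_eq_sum_range, partialSum]
  congr 1
  refine Finset.sum_congr rfl fun k hk => Finset.sum_congr rfl fun i hi => ?_
  rw [h i (by have := Finset.mem_range.1 hk; have := Finset.mem_range.1 hi; omega)]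

variable [∀ k, NeZero (m k)]

/-! ### Coefficients and partial sums of cylinder functions -/

section PartialSums

theorem integrable_of_const_on_cyl {n : ℕ} {g : G m → ℂ}
    (hg : ∀ x, ∀ y ∈ cyl m n x, g y = g x) : Integrable g (haar m) := by
  rw [funext (eq_sum_indicator hg)]
  exact integrable_finsetSum _ fun z _ =>
    (integrable_const _).indicator (measurableSet_cyl m n _)

theorem integrable_mul_psi {g : G m → ℂ} (hg : Integrable g (haar m)) (i : ℕ) :
    Integrable (fun x => g x * psi m i x) (haar m) :=
  hg.mul_bdd (c := 1) (measurable_psi i).aestronglyMeasurable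
    (Eventually.of_forall fun x => (norm_psi i x).le)

theorem integrable_mul_conj_psi {g : G m → ℂ} (hg : Integrable g (haar m)) (i : ℕ) :
    Integrable (fun x => g x * (starRingEnd ℂ) (psi m i x)) (haar m) :=
  hg.mul_bdd (c := 1)
    (Complex.continuous_conj.measurable.comp (measurable_psi i)).aestronglyMeasurable
    (Eventually.of_forall fun x => by simp [norm_psi])

theorem coeff_add {g h : G m → ℂ} (hg : Integrable g (haar m)) (hh : Integrable h (haar m))
    (i : ℕ) : coeff (fun x => g x + h x) i = coeff g i + coeff h i := by
  simp only [coeff, add_mul]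
  exact integral_add (integrable_mul_conj_psi hg i) (integrable_mul_conj_psi hh i)

theorem coeff_sub {g h : G m → ℂ} (hg : Integrable g (haar m)) (hh : Integrable h (haar m))
    (i : ℕ) : coeff (fun x => g x - h x) i = coeff g i - coeff h i := by
  simp only [coeff, sub_mul]
  exact integral_sub (integrable_mul_conj_psi hg i) (integrable_mul_conj_psi hh i)

theorem integrable_mul_dirichletKernel {g : G m → ℂ} (hg : Integrable g (haar m)) (n : ℕ)
    (x : G m) : Integrable (fun t => g t * dirichletKernel m n x t) (haar m) := by
  simp only [dirichletKernel, Finset.mul_sum]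
  refine integrable_finsetSum _ fun k _ => ?_
  refine ((integrable_mul_conj_psi hg k).const_mul (psi m k x)).congr (.of_forall fun t => ?_)
  ring

theorem partialSum_coeff_eq_integral {g : G m → ℂ} (hg : Integrable g (haar m)) (n : ℕ)
    (x : G m) : partialSum (coeff g) n x = ∫ t, g t * dirichletKernel m n x t ∂haar m := by
  have (t : G m) : g t * dirichletKernel m n x t = ∑ k ∈ Finset.range n,
      g t * (starRingEnd ℂ) (psi m k t) * psi m k x := by
    rw [dirichletKernel, Finset.mul_sum]
    exact Finset.sum_congr rfl fun k _ => by ring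
  simp_rw [this]
  rw [integral_finsetSum _ fun k _ => (integrable_mul_conj_psi hg k).mul_const _]
  exact Finset.sum_congr rfl fun k _ => (integral_mul_const _ _).symm

theorem fejer_coeff_eq_integral {g : G m → ℂ} (hg : Integrable g (haar m)) (n : ℕ)
    (x : G m) :
    fejer (coeff g) n x = (1 / (n : ℂ)) * ∫ t, g t * fejerKernel m n x t ∂haar m := by
  simp only [fejer_eq_sum_range, fejerKernel, Finset.mul_sum]
  rw [integral_finsetSum _ fun k _ => integrable_mul_dirichletKernel hg _ x, Finset.mul_sum]
  exact Finset.sum_congr rfl fun k _ => by rw [partialSum_coeff_eq_integral hg]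

theorem partialSum_M_eq_setIntegral (hm : ∀ k, 2 ≤ m k) {g : G m → ℂ}
    (hg : Integrable g (haar m)) (N : ℕ) (x : G m) :
    partialSum (coeff g) (M m N) x = M m N * ∫ t in cyl m N x, g t ∂haar m := by
  rw [partialSum_coeff_eq_integral hg, ← integral_indicator (measurableSet_cyl m N x),
    ← integral_const_mul]
  refine integral_congr_ae (.of_forall fun t => ?_)
  by_cases h : t ∈ cyl m N x
  · simp only [dirichletKernel_M hm, Set.indicator_of_mem (mem_cyl_comm.1 h),
      Set.indicator_of_mem h, mul_comm]
  · simp [dirichletKernel_M hm, h, mem_cyl_comm.not.1 h]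

theorem M_mul_setIntegral_cyl (hm : ∀ k, 2 ≤ m k) {N : ℕ} {g : G m → ℂ}
    (hg : ∀ x, ∀ y ∈ cyl m N x, g y = g x) (x : G m) :
    M m N * ∫ t in cyl m N x, g t ∂haar m = g x := by
  have hM : (M m N : ℂ) ≠ 0 := by exact_mod_cast (M_pos hm N).ne'
  rw [setIntegral_congr_fun (measurableSet_cyl m N x) (g := fun _ => g x) (hg x),
    setIntegral_const, Measure.real, haar_cyl, Complex.real_smul]
  simp [hM]

theorem partialSum_M_eq_self (hm : ∀ k, 2 ≤ m k) {N : ℕ} {g : G m → ℂ}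
    (hg : ∀ x, ∀ y ∈ cyl m N x, g y = g x) (x : G m) :
    partialSum (coeff g) (M m N) x = g x := by
  rw [partialSum_M_eq_setIntegral hm (integrable_of_const_on_cyl hg), M_mul_setIntegral_cyl hm hg]

/-- A Parseval-type identity obtained by expanding the partial sum; orthogonality of the system is
not needed. -/
theorem sum_norm_sq_coeff {g : G m → ℂ} (hg : Integrable g (haar m)) (n : ℕ) :
    ((∑ i ∈ Finset.range n, ‖coeff g i‖ ^ 2 : ℝ) : ℂ) =
      ∫ x, (starRingEnd ℂ) (g x) * partialSum (coeff g) n x ∂haar m := by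
  have hg' : Integrable (fun x => (starRingEnd ℂ) (g x)) (haar m) :=
    ⟨Complex.continuous_conj.comp_aestronglyMeasurable hg.1, by
      simpa [HasFiniteIntegral] using hg.2⟩
  have (x : G m) : (starRingEnd ℂ) (g x) * partialSum (coeff g) n x =
      ∑ i ∈ Finset.range n, (starRingEnd ℂ) (g x) * psi m i x * coeff g i := by
    rw [partialSum, Finset.mul_sum]
    exact Finset.sum_congr rfl fun k _ => by ring
  simp_rw [this]
  rw [integral_finsetSum _ fun k _ => (integrable_mul_psi hg' k).mul_const _]
  push_cast
  refine Finset.sum_congr rfl fun i _ => ?_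
  rw [integral_mul_const, ← Complex.conj_mul' (coeff g i)]
  congr 1
  rw [coeff, ← integral_conj]
  simp

theorem coeff_eq_zero_of_partialSum_eq_zero {g : G m → ℂ} (hg : Integrable g (haar m)) {n : ℕ}
    (h : ∀ x : G m, partialSum (coeff g) n x = 0) {i : ℕ} (hi : i < n) : coeff g i = 0 := by
  have h0 := sum_norm_sq_coeff hg n
  simp only [h, mul_zero, integral_zero, Complex.ofReal_eq_zero] at h0
  have := (Finset.sum_eq_zero_iff_of_nonneg fun _ _ => by positivity).1 h0 i
    (Finset.mem_range.2 hi)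
  simpa using this

/-- For `K ≥ N` the partial sum of index `M_K` is `g` itself, so `∑_{i < M_K} |c_i|²` does not
depend on `K` and all later terms vanish. -/
theorem coeff_eq_zero_of_M_le (hm : ∀ k, 2 ≤ m k) {N : ℕ} {g : G m → ℂ}
    (hg : ∀ x, ∀ y ∈ cyl m N x, g y = g x) {i : ℕ} (hi : M m N ≤ i) : coeff g i = 0 := by
  have hint := integrable_of_const_on_cyl hg
  have key (K : ℕ) (hK : N ≤ K) : ((∑ i ∈ Finset.range (M m K), ‖coeff g i‖ ^ 2 : ℝ) : ℂ) =
      ∫ x, (starRingEnd ℂ) (g x) * g x ∂haar m := by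
    rw [sum_norm_sq_coeff hint]
    simp_rw [partialSum_M_eq_self hm fun x y hy => hg x y (mem_cyl_of_le hK hy)]
  have hK : N ≤ max N i := le_max_left _ _
  have hiK : i < M m (max N i) := (lt_M hm i).trans_le (M_mono hm (le_max_right _ _))
  have heq := Complex.ofReal_injective ((key _ hK).trans (key N le_rfl).symm)
  rw [← Finset.sum_range_add_sum_Ico _ (M_mono hm hK), add_eq_left] at heq
  have := (Finset.sum_eq_zero_iff_of_nonneg fun _ _ => by positivity).1 heq i
    (Finset.mem_Ico.2 ⟨hi, hiK⟩)
  simpa using this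

theorem partialSum_eq_self (hm : ∀ k, 2 ≤ m k) {N : ℕ} {g : G m → ℂ}
    (hg : ∀ x, ∀ y ∈ cyl m N x, g y = g x) {n : ℕ} (hn : M m N ≤ n) (x : G m) :
    partialSum (coeff g) n x = g x := by
  rw [← partialSum_M_eq_self hm hg, partialSum, partialSum]
  refine (Finset.sum_subset (Finset.range_mono hn) fun k _ hk => ?_).symm
  rw [coeff_eq_zero_of_M_le hm hg (by simpa using hk), zero_mul]

end PartialSums

/-! ### Fejér means of cylinder functions -/

section FejerMeans

theorem fejer_coeff_add {g h : G m → ℂ} (hg : Integrable g (haar m)) (hh : Integrable h (haar m))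
    (n : ℕ) (x : G m) :
    fejer (coeff fun x => g x + h x) n x = fejer (coeff g) n x + fejer (coeff h) n x := by
  simp only [fejer, partialSum, coeff_add hg hh, add_mul, Finset.sum_add_distrib, mul_add]

/-- In `n (σ_n g - g) = ∑_{k ≤ n} (S_k g - g)` every term with `k ≥ M_N` is zero, so the sum is the
same as for `n = M_N`. -/
theorem fejer_sub_self (hm : ∀ k, 2 ≤ m k) {N : ℕ} {g : G m → ℂ}
    (hg : ∀ x, ∀ y ∈ cyl m N x, g y = g x) {n : ℕ} (hn : M m N ≤ n) (x : G m) :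
    fejer (coeff g) n x - g x = (M m N / n : ℂ) * (fejer (coeff g) (M m N) x - g x) := by
  have hM : (M m N : ℂ) ≠ 0 := by exact_mod_cast (M_pos hm N).ne'
  have hn0 : (n : ℂ) ≠ 0 := by exact_mod_cast ((M_pos hm N).trans_le hn).ne'
  have : ∑ k ∈ Finset.Ico (M m N) n, partialSum (coeff g) (k + 1) x = (n - M m N : ℂ) * g x := by
    rw [Finset.sum_congr rfl fun k hk => partialSum_eq_self hm hg
      ((Finset.mem_Ico.1 hk).1.trans (Nat.le_succ k)) x]
    simp [Nat.cast_sub hn]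
  rw [fejer_eq_sum_range, fejer_eq_sum_range, ← Finset.sum_range_add_sum_Ico _ hn, this]
  field_simp
  ring

theorem lintegral_fejer_sub_self_le (hm : ∀ k, 2 ≤ m k) {N : ℕ} {g : G m → ℂ}
    (hg : ∀ x, ∀ y ∈ cyl m N x, g y = g x) {n : ℕ} (hn : M m N ≤ n) {p : ℝ} (hp0 : 0 < p) :
    ∫⁻ x, ‖fejer (coeff g) n x - g x‖ₑ ^ p ∂haar m ≤ ((M m N : ℝ≥0∞) / n) ^ p *
      ∫⁻ x, ‖fejer (coeff g) (M m N) x - g x‖ₑ ^ p ∂haar m := by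
  have hn0 : 0 < n := (M_pos hm N).trans_le hn
  have hn0' : (0 : ℝ) < n := by exact_mod_cast hn0
  rw [← lintegral_const_mul']
  · refine lintegral_mono fun x => ?_
    rw [fejer_sub_self hm hg hn, enorm_mul, ENNReal.mul_rpow_of_nonneg _ _ hp0.le]
    gcongr
    rw [← ofReal_norm, norm_div, Complex.norm_natCast, Complex.norm_natCast,
      ENNReal.ofReal_div_of_pos hn0', ENNReal.ofReal_natCast, ENNReal.ofReal_natCast]
  · exact ENNReal.rpow_ne_top_of_nonneg hp0.le
      (ENNReal.div_ne_top (by simp) (by exact_mod_cast hn0.ne'))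

/-- The reverse Hölder inequality moves the power inside the convolution integral, after which
Tonelli separates `g` from the kernel. -/
theorem lintegral_fejer_rpow_le (hm : ∀ k, 2 ≤ m k) {N n : ℕ} (hn : n ≤ M m N) {g : G m → ℂ}
    (hg : ∀ x, ∀ y ∈ cyl m N x, g y = g x) {p : ℝ} (hp0 : 0 < p) (hp1 : p ≤ 1) {A : ℝ≥0∞}
    (hA : ∀ t, ∫⁻ x, ‖fejerKernel m n x t‖ₑ ^ p ∂haar m ≤ A) :
    ∫⁻ x, ‖fejer (coeff g) n x‖ₑ ^ p ∂haar m ≤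
      (n : ℝ≥0∞)⁻¹ ^ p * (M m N : ℝ≥0∞) ^ (1 - p) * A * ∫⁻ t, ‖g t‖ₑ ^ p ∂haar m := by
  rcases Nat.eq_zero_or_pos n with rfl | hn0
  · simp [fejer, hp0]
  have hgm : Measurable g := measurable_of_const_on_cyl hg
  have hFm := measurable_fejerKernel (m := m) n
  have hc : (n : ℝ≥0∞)⁻¹ ^ p * (M m N : ℝ≥0∞) ^ (1 - p) ≠ ∞ :=
    ENNReal.mul_ne_top (ENNReal.rpow_ne_top_of_nonneg hp0.le (by simp [hn0.ne']))
      (ENNReal.rpow_ne_top_of_nonneg (by linarith) (by simp))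
  have hpt (x : G m) : ‖fejer (coeff g) n x‖ₑ ^ p ≤ (n : ℝ≥0∞)⁻¹ ^ p * (M m N : ℝ≥0∞) ^ (1 - p) *
      ∫⁻ t, ‖g t‖ₑ ^ p * ‖fejerKernel m n x t‖ₑ ^ p ∂haar m := by
    rw [fejer_coeff_eq_integral (integrable_of_const_on_cyl hg), enorm_mul,
      ENNReal.mul_rpow_of_nonneg _ _ hp0.le, mul_assoc]
    gcongr
    · rw [one_div, enorm_inv (by exact_mod_cast hn0.ne'), ← ofReal_norm]; simp
    · calc _ ≤ (∫⁻ t, ‖g t‖ₑ * ‖fejerKernel m n x t‖ₑ ∂haar m) ^ p := by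
            gcongr
            refine (enorm_integral_le_lintegral_enorm _).trans_eq ?_
            simp only [enorm_mul]
        _ ≤ _ := lintegral_rpow_le hm (n := N) (fun t y hy => by
            rw [hg t y hy, fejerKernel_congr_right hm hn hy]) hp0 hp1
        _ = _ := by simp only [ENNReal.mul_rpow_of_nonneg _ _ hp0.le]
  calc _ ≤ ∫⁻ x, (n : ℝ≥0∞)⁻¹ ^ p * (M m N : ℝ≥0∞) ^ (1 - p) *
        ∫⁻ t, ‖g t‖ₑ ^ p * ‖fejerKernel m n x t‖ₑ ^ p ∂haar m ∂haar m := lintegral_mono hpt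
    _ = (n : ℝ≥0∞)⁻¹ ^ p * (M m N : ℝ≥0∞) ^ (1 - p) *
        ∫⁻ t, ∫⁻ x, ‖g t‖ₑ ^ p * ‖fejerKernel m n x t‖ₑ ^ p ∂haar m ∂haar m := by
        rw [lintegral_const_mul' _ _ hc, lintegral_lintegral_swap]
        exact (((hgm.comp measurable_snd).enorm.pow_const p).mul
          (hFm.enorm.pow_const p)).aemeasurable
    _ ≤ (n : ℝ≥0∞)⁻¹ ^ p * (M m N : ℝ≥0∞) ^ (1 - p) * ∫⁻ t, A * ‖g t‖ₑ ^ p ∂haar m := by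
        gcongr with t
        rw [lintegral_const_mul' _ _ (ENNReal.rpow_ne_top_of_nonneg hp0.le (by simp)), mul_comm]
        gcongr
        exact hA t
    _ = _ := by
        rw [lintegral_const_mul _ (hgm.enorm.pow_const p)]
        ring

end FejerMeans

end Vilenkin

namespace Vilenkin

variable {m : ℕ → ℕ}

/-- This is where the exponent `2[1/2 + p]` originates: a convergent geometric series for `p < 1/2`,
and `N + 1 ≤ 2N` unit terms for `p = 1/2`. -/
theorem exists_sum_M_rpow_le (hm : ∀ k, 2 ≤ m k) {p : ℝ} (hp0 : 0 < p) (hp : p ≤ 1 / 2) :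
    ∃ K : ℝ, 0 ≤ K ∧ ∀ N : ℕ, 1 ≤ N → ∑ s ∈ Finset.range (N + 1), (M m s : ℝ) ^ (2 * p - 1) ≤
      K * ((N : ℝ) ^ (2 * ⌊1 / 2 + p⌋₊)) ^ p := by
  rcases hp.lt_or_eq with hlt | rfl
  · have hfl : ⌊1 / 2 + p⌋₊ = 0 := Nat.floor_eq_zero.2 (by linarith)
    set q : ℝ := 2 ^ (2 * p - 1) with hq
    have hq0 : 0 ≤ q := by positivity
    have hq1 : q < 1 := Real.rpow_lt_one_of_one_lt_of_neg one_lt_two (by linarith)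
    refine ⟨(1 - q)⁻¹, by simp [hq1.le], fun N _ => ?_⟩
    rw [hfl]
    simp only [mul_zero, pow_zero, Real.one_rpow, mul_one]
    calc _ ≤ ∑ s ∈ Finset.range (N + 1), q ^ s := by
          refine Finset.sum_le_sum fun s _ => ?_
          rw [hq, ← Real.rpow_mul_natCast two_pos.le, mul_comm _ (s : ℝ),
            Real.rpow_natCast_mul two_pos.le]
          refine Real.rpow_le_rpow_of_nonpos (by positivity) ?_ (by linarith)
          exact_mod_cast two_pow_le_M hm s
      _ ≤ _ := by
          rw [← tsum_geometric_of_lt_one hq0 hq1]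
          exact (summable_geometric_of_lt_one hq0 hq1).sum_le_tsum _ fun _ _ => by positivity
  · refine ⟨2, by norm_num, fun N hN => ?_⟩
    have hfl : ⌊(1 / 2 + 1 / 2 : ℝ)⌋₊ = 1 := by norm_num
    have hN' : (1 : ℝ) ≤ N := by exact_mod_cast hN
    rw [hfl, ← Real.rpow_natCast_mul (by positivity)]
    norm_num
    linarith

/-- The maximal function of the martingale `f - S_{M_N} f`. -/
noncomputable def remainder (f : ℕ → G m → ℂ) (N : ℕ) (x : G m) : ℝ≥0∞ :=
  ⨆ k, ‖f k x - f (min k N) x‖ₑ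

theorem enorm_sub_le_remainder {f : ℕ → G m → ℂ} {k N : ℕ} (hk : N ≤ k) (x : G m) :
    ‖f k x - f N x‖ₑ ≤ remainder f N x := by
  calc ‖f k x - f N x‖ₑ = ‖f k x - f (min k N) x‖ₑ := by rw [min_eq_right hk]
    _ ≤ _ := le_iSup (fun k => ‖f k x - f (min k N) x‖ₑ) k

variable [∀ k, NeZero (m k)]

/-! ### Martingale components, remainders and the pointwise limit -/

section Martingales

theorem const_on_cyl_of_stronglyMeasurable {k : ℕ} {g : G m → ℂ}
    (hg : StronglyMeasurable[filt m k] g) (x y : G m) (hy : y ∈ cyl m k x) : g y = g x := by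
  have hs : MeasurableSet[filt m k] (g ⁻¹' {g x}) :=
    hg.measurable (MeasurableSet.singleton (g x))
  have key : ∀ s, MeasurableSet[filt m k] s → (x ∈ s ↔ y ∈ s) := by
    refine MeasurableSpace.forall_generateFrom_mem_iff_mem_iff.2 ?_
    rintro _ ⟨z, rfl⟩
    exact forall₂_congr fun j hj => by rw [hy j hj]
  exact (key _ hs).1 rfl

theorem measurableSet_filt_cyl (k : ℕ) (x : G m) : MeasurableSet[filt m k] (cyl m k x) :=
  MeasurableSpace.measurableSet_generateFrom ⟨x, rfl⟩

variable {f : ℕ → G m → ℂ}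

theorem martingale_const_on_cyl (hf : Martingale f (filt m) (haar m)) (k : ℕ) :
    ∀ x, ∀ y ∈ cyl m k x, f k y = f k x :=
  const_on_cyl_of_stronglyMeasurable (hf.stronglyMeasurable k)

theorem martingale_const_on_cyl_of_le (hf : Martingale f (filt m) (haar m)) {k N : ℕ}
    (hk : k ≤ N) : ∀ x, ∀ y ∈ cyl m N x, f k y = f k x :=
  fun x y hy => martingale_const_on_cyl hf k x y (mem_cyl_of_le hk hy)

theorem partialSum_M_martingale (hm : ∀ k, 2 ≤ m k) (hf : Martingale f (filt m) (haar m))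
    (k N : ℕ) (x : G m) : partialSum (coeff (f k)) (M m N) x = f (min k N) x := by
  rcases le_total k N with h | h
  · rw [min_eq_left h, partialSum_M_eq_self hm (martingale_const_on_cyl_of_le hf h)]
  · rw [min_eq_right h, partialSum_M_eq_setIntegral hm (hf.integrable k),
      ← hf.setIntegral_eq h (measurableSet_filt_cyl N x),
      M_mul_setIntegral_cyl hm (martingale_const_on_cyl hf N)]

/-- Both components have the same partial sum of index `M_N`, and the Parseval-type identity passes
from partial sums to coefficients. -/
theorem coeff_martingale_eq (hm : ∀ k, 2 ≤ m k) (hf : Martingale f (filt m) (haar m))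
    {k N i : ℕ} (hk : N ≤ k) (hi : i < M m N) : coeff (f k) i = coeff (f N) i := by
  have hsub := coeff_sub (hf.integrable k) (hf.integrable N)
  rw [← sub_eq_zero, ← hsub]
  refine coeff_eq_zero_of_partialSum_eq_zero ((hf.integrable k).sub (hf.integrable N))
    (fun x => ?_) hi
  have : partialSum (coeff fun x => f k x - f N x) (M m N) x =
      partialSum (coeff (f k)) (M m N) x - partialSum (coeff (f N)) (M m N) x := by
    simp only [partialSum, hsub, sub_mul, Finset.sum_sub_distrib]
  exact this.trans (by simp [partialSum_M_martingale hm hf, hk])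

theorem martCoeff_eq (hm : ∀ k, 2 ≤ m k) (hf : Martingale f (filt m) (haar m))
    {N i : ℕ} (hi : i < M m N) : martCoeff f i = coeff (f N) i := by
  refine Tendsto.limUnder_eq (tendsto_const_nhds.congr' ?_)
  filter_upwards [eventually_ge_atTop N] with k hk
  exact (coeff_martingale_eq hm hf hk hi).symm

theorem martingale_measurable (hf : Martingale f (filt m) (haar m)) (k : ℕ) : Measurable (f k) :=
  measurable_of_const_on_cyl (martingale_const_on_cyl hf k)

theorem measurable_remainder (hf : Martingale f (filt m) (haar m)) (N : ℕ) :
    Measurable (remainder f N) :=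
  .iSup fun k => ((martingale_measurable hf k).sub (martingale_measurable hf _)).enorm

theorem modulus_eq (hm : ∀ k, 2 ≤ m k) (hf : Martingale f (filt m) (haar m)) (p : ℝ) (N : ℕ) :
    modulus p f N = (∫⁻ x, remainder f N x ^ p ∂haar m) ^ (1 / p) := by
  simp only [modulus, hpNorm, maximal, partialSum_M_martingale hm hf, remainder]

theorem lintegral_maximal_lt_top {p : ℝ} (hp0 : 0 < p) (h : hpNorm p f < ∞) :
    ∫⁻ x, maximal f x ^ p ∂haar m < ∞ :=
  (ENNReal.rpow_lt_top_iff_of_pos (by positivity)).1 h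

theorem lintegral_remainder_lt_top {p : ℝ} (hp0 : 0 < p) (hp1 : p ≤ 1) (hf : MemHp p f) (N : ℕ) :
    ∫⁻ x, remainder f N x ^ p ∂haar m < ∞ := by
  have hmeas : Measurable fun x => maximal f x ^ p :=
    (Measurable.iSup fun k => (martingale_measurable hf.1 k).enorm).pow_const p
  have hfin := lintegral_maximal_lt_top hp0 hf.2
  calc _ ≤ ∫⁻ x, (maximal f x ^ p + maximal f x ^ p) ∂haar m := by
        refine lintegral_mono fun x => ?_
        refine le_trans ?_ (ENNReal.rpow_add_le_add_rpow _ _ hp0.le hp1)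
        refine ENNReal.rpow_le_rpow (iSup_le fun k => (enorm_sub_le).trans ?_) hp0.le
        exact add_le_add (le_iSup (fun k => ‖f k x‖ₑ) k) (le_iSup (fun k => ‖f k x‖ₑ) _)
    _ < ∞ := by
        rw [lintegral_add_left hmeas]
        exact ENNReal.add_lt_top.2 ⟨hfin, hfin⟩

/-- Membership in `H_p` makes the modulus finite, so the real-valued growth hypothesis loses nothing
through `toReal`. -/
theorem lintegral_remainder_eq (hm : ∀ k, 2 ≤ m k) {p : ℝ} (hp0 : 0 < p) (hp1 : p ≤ 1)
    (hf : MemHp p f) (N : ℕ) :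
    ∫⁻ x, remainder f N x ^ p ∂haar m = ENNReal.ofReal ((modulus p f N).toReal ^ p) := by
  have hfin := (lintegral_remainder_lt_top hp0 hp1 hf N).ne
  rw [modulus_eq hm hf.1, ← ENNReal.toReal_rpow, ← Real.rpow_mul ENNReal.toReal_nonneg,
    one_div_mul_cancel hp0.ne', Real.rpow_one, ENNReal.ofReal_toReal hfin]

/-- The infimum over `N` of the remainders vanishes almost everywhere, and a small remainder at one
`N` controls all later components: the sequence is Cauchy there. -/
theorem ae_exists_tendsto (hf : Martingale f (filt m) (haar m)) {p : ℝ} (hp0 : 0 < p)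
    (h : Tendsto (fun N => ∫⁻ x, remainder f N x ^ p ∂haar m) atTop (𝓝 0)) :
    ∀ᵐ x ∂haar m, ∃ l, Tendsto (fun k => f k x) atTop (𝓝 l) := by
  have hmeas : Measurable fun x => ⨅ N, remainder f N x ^ p :=
    .iInf fun N => (measurable_remainder hf N).pow_const p
  have h0 : ∫⁻ x, ⨅ N, remainder f N x ^ p ∂haar m = 0 := by
    refine le_antisymm (ge_of_tendsto' h fun N => lintegral_mono fun x => iInf_le _ N) zero_le
  rw [lintegral_eq_zero_iff hmeas] at h0
  filter_upwards [h0] with x hx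
  refine cauchySeq_tendsto_of_complete (EMetric.cauchySeq_iff'.2 fun ε hε => ?_)
  have hlt : ⨅ N, remainder f N x ^ p < ε ^ p := by
    rw [show ⨅ N, remainder f N x ^ p = 0 from hx]
    exact ENNReal.rpow_pos_of_nonneg hε hp0.le
  obtain ⟨N, hN⟩ := iInf_lt_iff.1 hlt
  refine ⟨N, fun k hk => ?_⟩
  rw [edist_eq_enorm_sub]
  exact (enorm_sub_le_remainder hk x).trans_lt ((ENNReal.rpow_lt_rpow_iff hp0).1 hN)

end Martingales

/-! ### Consequences of the growth hypothesis and a contraction lemma -/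

section Growth

/-- The `p`-th power of the hypothesis: `(1/p - 2) p = 1 - 2p` matches the weight, and the power of
`N` matches the kernel sum. -/
theorem tendsto_weighted_remainder (hm : ∀ k, 2 ≤ m k) {p : ℝ} (hp0 : 0 < p) (hp : p ≤ 1 / 2)
    {f : ℕ → G m → ℂ} (hf : MemHp p f)
    (hω : (fun N : ℕ => (modulus p f N).toReal) =o[atTop]
      fun N : ℕ => 1 / ((M m N : ℝ) ^ (1 / p - 2) * (N : ℝ) ^ (2 * ⌊1 / 2 + p⌋₊))) :
    Tendsto (fun N => (M m N : ℝ≥0∞) ^ (1 - 2 * p) *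
      (∑ s ∈ Finset.range (N + 1), (M m s : ℝ≥0∞) ^ (2 * p - 1)) *
      ∫⁻ x, remainder f N x ^ p ∂haar m) atTop (𝓝 0) := by
  obtain ⟨K, hK0, hK⟩ := exists_sum_M_rpow_le hm hp0 hp
  have h1 := (hω.tendsto_div_nhds_zero.rpow_const (p := p) (Or.inr hp0.le)).const_mul K
  rw [Real.zero_rpow hp0.ne', mul_zero] at h1
  have h2 := ENNReal.tendsto_ofReal h1
  rw [ENNReal.ofReal_zero] at h2
  refine tendsto_of_tendsto_of_tendsto_of_le_of_le' tendsto_const_nhds h2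
    (Eventually.of_forall fun _ => zero_le) ?_
  filter_upwards [eventually_ge_atTop 1] with N hN
  have hM (s : ℕ) : (0 : ℝ) < M m s := by exact_mod_cast M_pos hm s
  have hN0 : (0 : ℝ) < N := by exact_mod_cast hN
  set ω := (modulus p f N).toReal
  have hω0 : 0 ≤ ω := ENNReal.toReal_nonneg
  rw [lintegral_remainder_eq hm hp0 (by linarith) hf, natCast_rpow_eq_ofReal (M_pos hm N),
    Finset.sum_congr rfl fun s _ => natCast_rpow_eq_ofReal (M_pos hm s) (2 * p - 1),
    ← ENNReal.ofReal_sum_of_nonneg fun s _ => by positivity,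
    ← ENNReal.ofReal_mul (by positivity),
    ← ENNReal.ofReal_mul (mul_nonneg (by positivity) (Finset.sum_nonneg fun s _ => by positivity))]
  refine ENNReal.ofReal_le_ofReal ?_
  have e : (M m N : ℝ) ^ (1 - 2 * p) = ((M m N : ℝ) ^ (1 / p - 2)) ^ p := by
    rw [← Real.rpow_mul (hM N).le]
    congr 1
    field_simp
  rw [div_div_eq_mul_div, div_one, Real.mul_rpow hω0 (by positivity),
    Real.mul_rpow (by positivity) (by positivity), ← e]
  calc _ ≤ (M m N : ℝ) ^ (1 - 2 * p) * (K * ((N : ℝ) ^ (2 * ⌊1 / 2 + p⌋₊)) ^ p) * ω ^ p := by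
        gcongr
        exact hK N hN
    _ = _ := by ring

theorem tendsto_zero_of_le_mul_add {u δ : ℕ → ℝ} {q : ℝ} (hq0 : 0 ≤ q) (hq1 : q < 1)
    (hu : ∀ n, 0 ≤ u n) (hrec : ∀ n, u (n + 1) ≤ q * u n + δ n)
    (hδ : Tendsto δ atTop (𝓝 0)) : Tendsto u atTop (𝓝 0) := by
  rw [Metric.tendsto_atTop]
  intro ε hε
  -- With this bound on `δ`, the level `ε / 2` is the fixed point of `u ↦ q u + δ`.
  have hε' : 0 < (1 - q) * (ε / 2) := mul_pos (by linarith) (by linarith)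
  obtain ⟨N, hN⟩ := eventually_atTop.1 (hδ.eventually (ge_mem_nhds hε'))
  have hbound (k : ℕ) : u (N + k) ≤ q ^ k * u N + ε / 2 := by
    induction k with
    | zero => simp; linarith
    | succ k ih =>
      calc u (N + k + 1) ≤ q * u (N + k) + δ (N + k) := hrec _
        _ ≤ q * (q ^ k * u N + ε / 2) + (1 - q) * (ε / 2) := by
            gcongr
            exact hN _ (by omega)
        _ = _ := by ring
  have hpow : Tendsto (fun k => q ^ k * u N) atTop (𝓝 0) := by
    simpa using (tendsto_pow_atTop_nhds_zero_of_lt_one hq0 hq1).mul_const (u N)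
  obtain ⟨k, hk⟩ := eventually_atTop.1 (hpow.eventually (gt_mem_nhds (half_pos hε)))
  refine ⟨N + k, fun n hn => ?_⟩
  have h1 := hbound (n - N)
  have h2 := hk (n - N) (by omega)
  rw [Nat.add_sub_cancel' (by omega)] at h1
  rw [Real.dist_eq, sub_zero, abs_of_nonneg (hu n)]
  linarith

end Growth

end Vilenkin

namespace Vilenkin

variable {m : ℕ → ℕ}

theorem exists_M_le_lt (hm : ∀ k, 2 ≤ m k) : ∃ ν : ℕ → ℕ, Tendsto ν atTop atTop ∧
    ∀ n, 1 ≤ n → M m (ν n) ≤ n ∧ n < M m (ν n + 1) := by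
  have hex (n : ℕ) : ∃ N, 1 ≤ n → M m N ≤ n ∧ n < M m (N + 1) := by
    have hfind : ∃ N, n < M m (N + 1) := ⟨n, (Nat.lt_succ_self n).trans (lt_M hm _)⟩
    classical
    refine ⟨Nat.find hfind, fun hn => ⟨?_, Nat.find_spec hfind⟩⟩
    rcases h : Nat.find hfind with _ | N
    · simpa [M] using hn
    · exact not_lt.1 (Nat.find_min hfind (by omega : N < Nat.find hfind))
  choose ν hν using hex
  refine ⟨ν, tendsto_atTop.2 fun K => ?_, hν⟩
  filter_upwards [eventually_ge_atTop (M m K)] with n hn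
  have h := (hν n ((M_pos hm K).trans_le hn)).2
  by_contra hlt
  exact absurd (hn.trans_lt h) (not_lt.2 (M_mono hm (by omega)))

theorem tendsto_rpow_zero {E : ℕ → ℝ≥0∞} (hE : Tendsto E atTop (𝓝 0)) {q : ℝ} (hq : 0 < q) :
    Tendsto (fun n => E n ^ q) atTop (𝓝 0) := by
  simpa [hq, Function.comp_def] using
    ((ENNReal.continuous_rpow_const (y := q)).tendsto 0).comp hE

variable [∀ k, NeZero (m k)]

/-! ### Convergence of the Fejér means -/

section Convergence

theorem measurable_fejer (c : ℕ → ℂ) (n : ℕ) : Measurable fun x : G m => fejer c n x :=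
  (Finset.measurable_sum _ fun _ _ => Finset.measurable_sum _ fun i _ =>
    (measurable_psi i).const_mul (c i)).const_mul _

theorem lintegral_rpow_enorm_add_le {p : ℝ} (hp0 : 0 < p) (hp1 : p ≤ 1) {a b : G m → ℂ}
    (ha : Measurable a) : ∫⁻ x, ‖a x + b x‖ₑ ^ p ∂haar m ≤
      ∫⁻ x, ‖a x‖ₑ ^ p ∂haar m + ∫⁻ x, ‖b x‖ₑ ^ p ∂haar m := by
  rw [← lintegral_add_left (ha.enorm.pow_const p)]
  refine lintegral_mono fun x => ?_
  exact (ENNReal.rpow_le_rpow (enorm_add_le _ _) hp0.le).trans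
    (ENNReal.rpow_add_le_add_rpow _ _ hp0.le hp1)

variable {f : ℕ → G m → ℂ} {p : ℝ}

theorem lintegral_sub_le_remainder (hp0 : 0 < p) {k N : ℕ} (hk : N ≤ k) :
    ∫⁻ x, ‖f k x - f N x‖ₑ ^ p ∂haar m ≤ ∫⁻ x, remainder f N x ^ p ∂haar m :=
  lintegral_mono fun x => ENNReal.rpow_le_rpow (enorm_sub_le_remainder hk x) hp0.le

theorem difference_const_on_cyl (hf : Martingale f (filt m) (haar m)) (N : ℕ) :
    ∀ x, ∀ y ∈ cyl m (N + 1) x, f (N + 1) y - f N y = f (N + 1) x - f N x := fun x y hy => by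
  rw [martingale_const_on_cyl hf (N + 1) x y hy,
    martingale_const_on_cyl_of_le hf (Nat.le_succ N) x y hy]

theorem fejer_martingale_succ (hf : Martingale f (filt m) (haar m)) (N n : ℕ) (x : G m) :
    fejer (coeff (f (N + 1))) n x =
      fejer (coeff (f N)) n x + fejer (coeff fun x => f (N + 1) x - f N x) n x := by
  rw [← fejer_coeff_add (h := fun x => f (N + 1) x - f N x) (hf.integrable N)
    ((hf.integrable (N + 1)).sub (hf.integrable N))]
  simp

/-- At the index `M_{N+1}` the Fejér mean is bounded on the martingale differences. -/
theorem exists_lintegral_fejer_difference_sub_le (hm : ∀ k, 2 ≤ m k) {C : ℕ}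
    (hC : ∀ k, m k ≤ C) (hp0 : 0 < p) (hp1 : p ≤ 1) (hf : Martingale f (filt m) (haar m)) :
    ∃ B : ℝ≥0∞, B ≠ ∞ ∧ ∀ N, ∫⁻ x, ‖fejer (coeff fun x => f (N + 1) x - f N x) (M m (N + 1)) x -
      (f (N + 1) x - f N x)‖ₑ ^ p ∂haar m ≤ B * ∫⁻ x, remainder f N x ^ p ∂haar m := by
  obtain ⟨B, hB, hle⟩ := exists_lintegral_fejerKernel_M_le hm hC hp0 hp1
  refine ⟨B + 1, by finiteness, fun N => ?_⟩
  have hM : (M m (N + 1) : ℝ≥0∞) ≠ 0 := by exact_mod_cast (M_pos hm _).ne'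
  have hd := lintegral_sub_le_remainder (f := f) hp0 (Nat.le_succ N)
  have h1 := lintegral_fejer_rpow_le hm le_rfl (difference_const_on_cyl hf N) hp0 hp1
    (hle (N + 1))
  -- The exponents `-p`, `1 - p` and `2p - 1` add up to zero, so no power of `M_{N+1}` remains.
  have hone : (M m (N + 1) : ℝ≥0∞)⁻¹ ^ p * (M m (N + 1) : ℝ≥0∞) ^ (1 - p) *
      (B * (M m (N + 1) : ℝ≥0∞) ^ (2 * p - 1)) = B := by
    rw [ENNReal.inv_rpow, ← ENNReal.rpow_neg, ← ENNReal.rpow_add _ _ hM (by simp), mul_left_comm,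
      ← ENNReal.rpow_add _ _ hM (by simp)]
    ring_nf
    simp
  rw [hone] at h1
  simp only [sub_eq_add_neg (fejer _ _ _)]
  refine (lintegral_rpow_enorm_add_le hp0 hp1 (measurable_fejer _ _)).trans ?_
  simp only [enorm_neg]
  rw [add_mul, one_mul]
  exact add_le_add (h1.trans (by gcongr)) hd

/-- For `M_N ≤ n < M_{N+1}` the Fejér mean of the martingale difference is controlled by the
remainder with the weight `M_N^{1-2p} ∑_{s≤N} M_s^{2p-1}`. -/
theorem exists_lintegral_fejer_difference_le (hm : ∀ k, 2 ≤ m k) {C : ℕ}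
    (hC : ∀ k, m k ≤ C) (hp0 : 0 < p) (hp1 : p ≤ 1) (hf : Martingale f (filt m) (haar m)) :
    ∃ B : ℝ≥0∞, B ≠ ∞ ∧ ∀ N n, M m N ≤ n → n < M m (N + 1) →
      ∫⁻ x, ‖fejer (coeff fun x => f (N + 1) x - f N x) n x‖ₑ ^ p ∂haar m ≤
        B * ((M m N : ℝ≥0∞) ^ (1 - 2 * p) *
          (∑ s ∈ Finset.range (N + 1), (M m s : ℝ≥0∞) ^ (2 * p - 1)) *
          ∫⁻ x, remainder f N x ^ p ∂haar m) := by
  obtain ⟨B, hB, hle⟩ := exists_lintegral_fejerKernel_le hm hC hp0 hp1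
  refine ⟨(C : ℝ≥0∞) ^ (1 - p) * B, ENNReal.mul_ne_top
    (ENNReal.rpow_ne_top_of_nonneg (by linarith) (by simp)) hB, fun N n hn1 hn2 => ?_⟩
  have hM : (M m N : ℝ≥0∞) ≠ 0 := by exact_mod_cast (M_pos hm _).ne'
  have hd := lintegral_sub_le_remainder (f := f) hp0 (Nat.le_succ N)
  have h1 := lintegral_fejer_rpow_le hm hn2.le (difference_const_on_cyl hf N) hp0 hp1
    (fun t => hle (N + 1) n t hn2)
  refine h1.trans ?_
  set L := ∑ s ∈ Finset.range (N + 1), (M m s : ℝ≥0∞) ^ (2 * p - 1)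
  calc _ ≤ (M m N : ℝ≥0∞)⁻¹ ^ p * ((C : ℝ≥0∞) * M m N) ^ (1 - p) * (B * L) *
        ∫⁻ x, remainder f N x ^ p ∂haar m := by
        gcongr
        · rw [M, Nat.cast_mul]
          gcongr
          exact hC N
    _ = ((M m N : ℝ≥0∞)⁻¹ ^ p * (M m N : ℝ≥0∞) ^ (1 - p)) * ((C : ℝ≥0∞) ^ (1 - p) * B * (L *
        ∫⁻ x, remainder f N x ^ p ∂haar m)) := by
        rw [ENNReal.mul_rpow_of_nonneg _ _ (by linarith)]
        ring
    _ = _ := by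
        rw [ENNReal.inv_rpow, ← ENNReal.rpow_neg, ← ENNReal.rpow_add _ _ hM (by simp),
          show -p + (1 - p) = 1 - 2 * p by ring]
        ring

/-- The solution of `u_0 = 0`, `u_{N+1} = q u_N + δ_N`. -/
noncomputable def geomRec (q : ℝ≥0∞) (δ : ℕ → ℝ≥0∞) : ℕ → ℝ≥0∞
  | 0 => 0
  | N + 1 => q * geomRec q δ N + δ N

theorem tendsto_geomRec {q : ℝ≥0∞} {δ : ℕ → ℝ≥0∞} (hq : q < 1) (hδ : ∀ N, δ N ≠ ∞)
    (h : Tendsto δ atTop (𝓝 0)) : Tendsto (geomRec q δ) atTop (𝓝 0) := by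
  have hfin (N : ℕ) : geomRec q δ N ≠ ∞ := by
    induction N with
    | zero => simp [geomRec]
    | succ N ih => exact ENNReal.add_ne_top.2 ⟨ENNReal.mul_ne_top hq.ne_top ih, hδ N⟩
  rw [← ENNReal.tendsto_toReal_iff hfin ENNReal.zero_ne_top]
  refine tendsto_zero_of_le_mul_add (q := q.toReal) (δ := fun N => (δ N).toReal)
    ENNReal.toReal_nonneg ?_ (fun _ => ENNReal.toReal_nonneg) (fun N => ?_) ?_
  · simpa using (ENNReal.toReal_lt_toReal hq.ne_top ENNReal.one_ne_top).2 hq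
  · rw [geomRec, ENNReal.toReal_add (ENNReal.mul_ne_top hq.ne_top (hfin N)) (hδ N),
      ENNReal.toReal_mul]
  · simpa using (ENNReal.tendsto_toReal_iff hδ ENNReal.zero_ne_top).2 h

/-- Raising `N` at least doubles the admissible `n`, which contracts the error of the earlier
components by `2^{-p}`; the new component adds only the error of one martingale difference. -/
theorem lintegral_fejer_sub_le_geomRec (hm : ∀ k, 2 ≤ m k) (hp0 : 0 < p) (hp1 : p ≤ 1)
    (hf : Martingale f (filt m) (haar m)) {δ : ℕ → ℝ≥0∞}
    (hδ : ∀ N, ∫⁻ x, ‖fejer (coeff fun x => f (N + 1) x - f N x) (M m (N + 1)) x -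
      (f (N + 1) x - f N x)‖ₑ ^ p ∂haar m ≤ δ N) (N : ℕ) :
    ∀ k ≤ N, ∀ n, M m N ≤ n →
      ∫⁻ x, ‖fejer (coeff (f k)) n x - f k x‖ₑ ^ p ∂haar m ≤ geomRec (2⁻¹ ^ p) δ N := by
  induction N with
  | zero =>
    intro k hk n hn
    obtain rfl : k = 0 := by omega
    have hc := martingale_const_on_cyl hf 0
    refine (lintegral_fejer_sub_self_le hm hc hn hp0).trans ?_
    -- `f^{(0)}` is constant and `σ_1 = S_1` reproduces it, so the recursion starts at zero.
    have (x : G m) : fejer (coeff (f 0)) (M m 0) x - f 0 x = 0 := by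
      rw [← partialSum_M_eq_self hm hc x, fejer_eq_sum_range]
      simp [M]
    simp [this, hp0, geomRec]
  | succ N ih =>
    have hstep : ∀ k ≤ N, ∀ n, M m (N + 1) ≤ n →
        ∫⁻ x, ‖fejer (coeff (f k)) n x - f k x‖ₑ ^ p ∂haar m ≤
          2⁻¹ ^ p * geomRec (2⁻¹ ^ p) δ N := by
      intro k hk n hn
      have h2 : 2 * M m N ≤ n := (Nat.mul_le_mul_right _ (hm N)).trans hn
      refine (lintegral_fejer_sub_self_le hm (martingale_const_on_cyl_of_le hf hk)
        (by omega : M m N ≤ n) hp0).trans ?_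
      gcongr
      · rw [ENNReal.div_le_iff_le_mul (.inr (by simp)) (.inl (by simp)), ← ENNReal.div_eq_inv_mul,
          ENNReal.le_div_iff_mul_le (by simp) (by simp), mul_comm]
        exact_mod_cast h2
      · exact ih k hk _ le_rfl
    intro k hk n hn
    rcases Nat.le_succ_iff.1 hk with hk | rfl
    · exact (hstep k hk n hn).trans le_self_add
    · have hd := difference_const_on_cyl hf N
      have hx (x : G m) : fejer (coeff (f (N + 1))) n x - f (N + 1) x =
          (fejer (coeff (f N)) n x - f N x) +
          (fejer (coeff fun x => f (N + 1) x - f N x) n x - (f (N + 1) x - f N x)) := by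
        rw [fejer_martingale_succ hf]; ring
      simp only [hx]
      refine (lintegral_rpow_enorm_add_le hp0 hp1
        ((measurable_fejer _ _).sub (martingale_measurable hf N))).trans ?_
      refine add_le_add (hstep N le_rfl n hn) ?_
      refine (lintegral_fejer_sub_self_le hm hd hn hp0).trans ?_
      refine (mul_le_of_le_one_left zero_le ?_).trans (hδ N)
      refine ENNReal.rpow_le_one ?_ hp0.le
      rw [ENNReal.div_le_iff_le_mul (.inr (by simp)) (.inl (by simp)), one_mul]
      exact_mod_cast hn

/-- A bound, uniform in `k`, for `‖σ_n f^{(k)} - f^{(k)}‖_p^p` with `M_N ≤ n < M_{N+1}`. -/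
theorem exists_lintegral_fejer_sub_le (hm : ∀ k, 2 ≤ m k) {C : ℕ} (hC : ∀ k, m k ≤ C)
    (hp0 : 0 < p) (hp1 : p ≤ 1) (hf : MemHp p f)
    (hW : Tendsto (fun N => ∫⁻ x, remainder f N x ^ p ∂haar m) atTop (𝓝 0))
    (hH : Tendsto (fun N => (M m N : ℝ≥0∞) ^ (1 - 2 * p) *
      (∑ s ∈ Finset.range (N + 1), (M m s : ℝ≥0∞) ^ (2 * p - 1)) *
      ∫⁻ x, remainder f N x ^ p ∂haar m) atTop (𝓝 0)) :
    ∃ E : ℕ → ℝ≥0∞, Tendsto E atTop (𝓝 0) ∧ ∀ N n k, M m N ≤ n → n < M m (N + 1) →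
      ∫⁻ x, ‖fejer (coeff (f k)) n x - f k x‖ₑ ^ p ∂haar m ≤ E N := by
  obtain ⟨B₁, hB₁, hle₁⟩ := exists_lintegral_fejer_difference_sub_le hm hC hp0 hp1 hf.1
  obtain ⟨B₂, hB₂, hle₂⟩ := exists_lintegral_fejer_difference_le hm hC hp0 hp1 hf.1
  have hU := lintegral_fejer_sub_le_geomRec hm hp0 hp1 hf.1 hle₁
  set U := geomRec (2⁻¹ ^ p) fun N => B₁ * ∫⁻ x, remainder f N x ^ p ∂haar m
  have hU0 : Tendsto U atTop (𝓝 0) := by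
    refine tendsto_geomRec (ENNReal.rpow_lt_one (by simp) hp0)
      (fun N => ENNReal.mul_ne_top hB₁ (lintegral_remainder_lt_top hp0 hp1 hf N).ne) ?_
    simpa using ENNReal.Tendsto.const_mul hW (.inr hB₁)
  refine ⟨fun N => U N + (B₂ * ((M m N : ℝ≥0∞) ^ (1 - 2 * p) *
      (∑ s ∈ Finset.range (N + 1), (M m s : ℝ≥0∞) ^ (2 * p - 1)) *
      ∫⁻ x, remainder f N x ^ p ∂haar m) + ∫⁻ x, remainder f N x ^ p ∂haar m), ?_, ?_⟩
  · simpa using hU0.add ((ENNReal.Tendsto.const_mul hH (.inr hB₂)).add hW)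
  intro N n k hn1 hn2
  rcases le_or_gt k N with hk | hk
  · exact (hU N k hk n hn1).trans le_self_add
  -- As `n < M_{N+1} ≤ M_k`, the mean of `f^{(k)}` is that of `f^{(N+1)}`; only the subtracted
  -- `f^{(k)}` retains `k`, and its distance to `f^{(N)}` is bounded by the remainder.
  · have hx (x : G m) : fejer (coeff (f k)) n x - f k x =
        (fejer (coeff (f N)) n x - f N x) +
        (fejer (coeff fun x => f (N + 1) x - f N x) n x + -(f k x - f N x)) := by
      rw [fejer_congr fun i hi => coeff_martingale_eq hm hf.1 (Nat.succ_le_of_lt hk) (hi.trans hn2),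
        fejer_martingale_succ hf.1]
      ring
    simp only [hx]
    refine (lintegral_rpow_enorm_add_le hp0 hp1
      ((measurable_fejer _ _).sub (martingale_measurable hf.1 N))).trans ?_
    refine add_le_add (hU N N le_rfl n hn1) ?_
    refine (lintegral_rpow_enorm_add_le hp0 hp1 (measurable_fejer _ _)).trans ?_
    simp only [enorm_neg]
    exact add_le_add (hle₂ N n hn1 hn2) (lintegral_sub_le_remainder hp0 hk.le)

end Convergence

end Vilenkin

/-- `‖σ_n f - f‖_p → 0` is asserted in both of its senses: for the function `g` to which the
martingale `f` converges almost everywhere, and for the martingale `σ_n f - f`, whose components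
are `σ_n f^{(k)} - f^{(k)}`. -/
theorem theorem1 (m : ℕ → ℕ) [∀ k, NeZero (m k)] (hm : ∀ k, 2 ≤ m k)
    (hbdd : ∃ C : ℕ, ∀ k, m k ≤ C) (p : ℝ) (hp0 : 0 < p) (hp : p ≤ 1 / 2)
    (f : ℕ → Vilenkin.G m → ℂ) (hf : Vilenkin.MemHp p f)
    (hω : (fun N : ℕ => (Vilenkin.modulus p f N).toReal) =o[atTop]
      fun N : ℕ => 1 / ((Vilenkin.M m N : ℝ) ^ (1 / p - 2) * (N : ℝ) ^ (2 * ⌊1 / 2 + p⌋₊))) :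
    (∃ g : Vilenkin.G m → ℂ, Measurable g ∧ Vilenkin.lpNorm p g < ∞ ∧
      (∀ᵐ x ∂Vilenkin.haar m, Tendsto (fun k => f k x) atTop (𝓝 (g x))) ∧
      Tendsto (fun n : ℕ => Vilenkin.lpNorm p
        (fun x => Vilenkin.fejer (Vilenkin.martCoeff f) n x - g x)) atTop (𝓝 0)) ∧
    Tendsto (fun n : ℕ => Vilenkin.martLpNorm p
      (fun k x => Vilenkin.fejer (Vilenkin.coeff (f k)) n x - f k x)) atTop (𝓝 0) := by
  obtain ⟨C, hC⟩ := hbdd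
  have hp1 : p ≤ 1 := by linarith
  have hq : 0 < 1 / p := by positivity
  have hH := Vilenkin.tendsto_weighted_remainder hm hp0 hp hf hω
  -- The weight is at least 1, because its summand `s = N` alone contributes `M_N^{1-2p} M_N^{2p-1}
  -- = 1`.
  have hW : Tendsto (fun N => ∫⁻ x, Vilenkin.remainder f N x ^ p ∂Vilenkin.haar m)
      atTop (𝓝 0) := by
    refine tendsto_of_tendsto_of_tendsto_of_le_of_le tendsto_const_nhds hH (fun _ => zero_le)
      fun N => le_mul_of_one_le_left zero_le ?_
    have hM : (Vilenkin.M m N : ℝ≥0∞) ≠ 0 := by exact_mod_cast (Vilenkin.M_pos hm N).ne'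
    calc (1 : ℝ≥0∞) = (Vilenkin.M m N : ℝ≥0∞) ^ (1 - 2 * p) *
          (Vilenkin.M m N : ℝ≥0∞) ^ (2 * p - 1) := by
          rw [← ENNReal.rpow_add _ _ hM (by simp)]; simp
      _ ≤ _ := by
          gcongr
          exact Finset.single_le_sum (f := fun s => (Vilenkin.M m s : ℝ≥0∞) ^ (2 * p - 1))
            (fun _ _ => zero_le) (Finset.self_mem_range_succ N)
  obtain ⟨E, hE, hbound⟩ := Vilenkin.exists_lintegral_fejer_sub_le hm hC hp0 hp1 hf hW hH
  obtain ⟨ν, hν, hνM⟩ := Vilenkin.exists_M_le_lt hm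
  constructor
  · obtain ⟨g, hg, hlim⟩ := measurable_limit_of_tendsto_metrizable_ae
      (fun k => (Vilenkin.martingale_measurable hf.1 k).aemeasurable)
      (Vilenkin.ae_exists_tendsto hf.1 hp0 hW)
    refine ⟨g, hg, ?_, hlim, ?_⟩
    · refine lt_of_le_of_lt (ENNReal.rpow_le_rpow (lintegral_mono_ae ?_) hq.le) hf.2
      filter_upwards [hlim] with x hx
      exact ENNReal.rpow_le_rpow (le_of_tendsto' hx.enorm
        fun k => le_iSup (fun k => ‖f k x‖ₑ) k) hp0.le
    · have hgN (N : ℕ) : ∫⁻ x, ‖f N x - g x‖ₑ ^ p ∂Vilenkin.haar m ≤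
          ∫⁻ x, Vilenkin.remainder f N x ^ p ∂Vilenkin.haar m := by
        refine lintegral_mono_ae ?_
        filter_upwards [hlim] with x hx
        refine ENNReal.rpow_le_rpow ?_ hp0.le
        rw [enorm_sub_rev]
        refine le_of_tendsto (hx.sub_const (f N x)).enorm ?_
        filter_upwards [eventually_ge_atTop N] with k hk
        exact Vilenkin.enorm_sub_le_remainder hk x
      have hE' := Vilenkin.tendsto_rpow_zero
        (by simpa using (hE.comp hν).add (hW.comp ((tendsto_add_atTop_nat 1).comp hν))) hq
      refine tendsto_of_tendsto_of_tendsto_of_le_of_le' tendsto_const_nhds hE'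
        (Eventually.of_forall fun _ => zero_le) ?_
      filter_upwards [eventually_ge_atTop 1] with n hn
      obtain ⟨hn1, hn2⟩ := hνM n hn
      refine ENNReal.rpow_le_rpow ?_ hq.le
      -- The component of index `ν n + 1` already carries every coefficient of `f` that `σ_n` uses.
      have hx (x : Vilenkin.G m) : Vilenkin.fejer (Vilenkin.martCoeff f) n x - g x =
          (Vilenkin.fejer (Vilenkin.coeff (f (ν n + 1))) n x - f (ν n + 1) x) +
          (f (ν n + 1) x - g x) := by
        rw [Vilenkin.fejer_congr fun i hi => Vilenkin.martCoeff_eq hm hf.1 (hi.trans hn2)]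
        ring
      simp only [hx]
      exact (Vilenkin.lintegral_rpow_enorm_add_le hp0 hp1 ((Vilenkin.measurable_fejer _ _).sub
        (Vilenkin.martingale_measurable hf.1 _))).trans
        (add_le_add (hbound _ n _ hn1 hn2) (hgN _))
  · refine tendsto_of_tendsto_of_tendsto_of_le_of_le' tendsto_const_nhds
      (Vilenkin.tendsto_rpow_zero (hE.comp hν) hq) (Eventually.of_forall fun _ => zero_le) ?_
    filter_upwards [eventually_ge_atTop 1] with n hn
    obtain ⟨hn1, hn2⟩ := hνM n hn
    exact iSup_le fun k => ENNReal.rpow_le_rpow (hbound _ n k hn1 hn2) hq.le
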